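/- Consider $N$ qubits, with Hilbert space $\mathcal H\cong(\mathbb C^2)^{\otimes N}$ and $d=2^N$, and a bipartition of the qubits into a set $A$ of $N_A$ qubits and its complement $B$ of $N_B=N-N_A$ qubits, so that $\mathcal H\cong\mathcal H_A\otimes\mathcal H_B$. A Pauli string is a tensor product over the $N$ qubits of matrices from $\{I,X,Y,Z\}$; the Pauli group consists of the Pauli strings with phases in $\{\pm1,\pm i\}$, and the Clifford group $\mathscr C_N$ is the normalizer of the Pauli group in the unitary group $\mathscr U_N$ of $\mathcal H$. Every $O\in\mathscr U_N$ has an operator Schmidt decomposition $O/\sqrt d=\sum_i\sqrt{\lambda_i}\,V_i\otimes W_i$ across $A|B$, with $\{V_i\}$ and $\{W_i\}$ orthonormal for the Hilbert–Schmidt scalar product, $\lambda_i>0$ and $\sum_i\lambda_i=1$; the operator entanglement $E(O)$ is an entropy of the probability distribution $(\lambda_i)$. Here the entropy may be any of the following: the Rényi entropy $\frac1{1-\alpha}\log\sum_i\lambda_i^\alpha$ of any order $\alpha\in[0,\infty]$ (with the Shannon entropy for $\alpha=1$ and $-\log\max_i\lambda_i$ for $\alpha=\infty$), the linear entropy $1-\sum_i\lambda_i^2$,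 or $\sum_i f(\lambda_i)$ for any strictly concave $f:[0,1]\to\mathbb R$ with $f(0)=f(1)=0$. Theorem. For every $U\in\mathscr U_N$, every bipartition $A|B$ and every such choice of entropy, the following are equivalent: (i) $E(U^\dagger P U)=0$ for every Pauli string $P$; (ii) there are unitaries $V$ on $\mathcal H_A$ and $W$ on $\mathcal H_B$ and a Clifford unitary $C\in\mathscr C_N$ such that $U^\dagger=(V\otimes W)\,C$. In words: all Heisenberg-evolved Pauli strings are unentangled across $A|B$ exactly when the inverse evolution $U^\dagger$ generates no nonlocal nonstabilizerness, which by definition means that $U^\dagger$ has the form in (ii). -/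

import Mathlib

open scoped Matrix Kronecker ENNReal

noncomputable section

/-- The computational basis of a family of qubits labelled by `ι`. -/
abbrev QubitBasis (ι : Type) : Type := ι → Fin 2

/-- Operators on the qubits labelled by `ι`, as matrices in the computational basis. -/
abbrev QubitOp (ι : Type) : Type := Matrix (QubitBasis ι) (QubitBasis ι) ℂ

/-- The unitary group on the qubits labelled by `ι`. -/
abbrev QubitUnitary (ι : Type) [Fintype ι] [DecidableEq ι] : Type :=
  Matrix.unitaryGroup (QubitBasis ι) ℂ

/-! ### Pauli strings, the Pauli group and the Clifford group -/

/-- Labels of the four single-qubit Pauli matrices. -/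
inductive Pauli : Type
  | I | X | Y | Z

/-- The single-qubit Pauli matrices. -/
def Pauli.matrix : Pauli → Matrix (Fin 2) (Fin 2) ℂ
  | .I => !![1, 0; 0, 1]
  | .X => !![0, 1; 1, 0]
  | .Y => !![0, -Complex.I; Complex.I, 0]
  | .Z => !![1, 0; 0, -1]

/-- The Pauli string `σ_{s 0} ⊗ σ_{s 1} ⊗ ⋯ ⊗ σ_{s (N-1)}` on `N` qubits. These strings are
representatives of the Pauli group modulo phases. -/
def pauliString {N : ℕ} (s : Fin N → Pauli) : QubitOp (Fin N) :=
  Matrix.of fun x y => ∏ i, (s i).matrix (x i) (y i)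

theorem Pauli.exists_matrix_mul (p q : Pauli) :
    ∃ (k : ℕ) (r : Pauli), p.matrix * q.matrix = Complex.I ^ k • r.matrix := by
  have h3 : Complex.I ^ 3 = -Complex.I := by
    rw [pow_succ, Complex.I_sq]; ring
  cases p <;> cases q
  · exact ⟨0, .I, by ext i j; fin_cases i <;> fin_cases j <;> simp [Pauli.matrix]⟩
  · exact ⟨0, .X, by ext i j; fin_cases i <;> fin_cases j <;> simp [Pauli.matrix]⟩
  · exact ⟨0, .Y, by ext i j; fin_cases i <;> fin_cases j <;> simp [Pauli.matrix]⟩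
  · exact ⟨0, .Z, by ext i j; fin_cases i <;> fin_cases j <;> simp [Pauli.matrix]⟩
  · exact ⟨0, .X, by ext i j; fin_cases i <;> fin_cases j <;> simp [Pauli.matrix]⟩
  · exact ⟨0, .I, by ext i j; fin_cases i <;> fin_cases j <;> simp [Pauli.matrix]⟩
  · exact ⟨1, .Z, by ext i j; fin_cases i <;> fin_cases j <;> simp [Pauli.matrix]⟩
  · exact ⟨3, .Y, by ext i j; fin_cases i <;> fin_cases j <;> simp [Pauli.matrix, h3]⟩
  · exact ⟨0, .Y, by ext i j; fin_cases i <;> fin_cases j <;> simp [Pauli.matrix]⟩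
  · exact ⟨3, .Z, by ext i j; fin_cases i <;> fin_cases j <;> simp [Pauli.matrix, h3]⟩
  · exact ⟨0, .I, by ext i j; fin_cases i <;> fin_cases j <;> simp [Pauli.matrix]⟩
  · exact ⟨1, .X, by ext i j; fin_cases i <;> fin_cases j <;> simp [Pauli.matrix]⟩
  · exact ⟨0, .Z, by ext i j; fin_cases i <;> fin_cases j <;> simp [Pauli.matrix]⟩
  · exact ⟨1, .Y, by ext i j; fin_cases i <;> fin_cases j <;> simp [Pauli.matrix]⟩
  · exact ⟨3, .X, by ext i j; fin_cases i <;> fin_cases j <;> simp [Pauli.matrix, h3]⟩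
  · exact ⟨0, .I, by ext i j; fin_cases i <;> fin_cases j <;> simp [Pauli.matrix]⟩

theorem exists_pauliString_mul {N : ℕ} (s t : Fin N → Pauli) :
    ∃ (k : ℕ) (r : Fin N → Pauli),
      pauliString s * pauliString t = Complex.I ^ k • pauliString r := by
  choose k r h using fun i => Pauli.exists_matrix_mul (s i) (t i)
  refine ⟨∑ i, k i, r, ?_⟩
  ext x y
  have h' : ∀ i, ∑ z, (s i).matrix (x i) z * (t i).matrix z (y i)
      = Complex.I ^ k i * (r i).matrix (x i) (y i) := fun i => by
    have := congrFun (congrFun (h i) (x i)) (y i)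
    simpa [Matrix.mul_apply] using this
  simp only [pauliString, Matrix.mul_apply, Matrix.of_apply, Matrix.smul_apply, smul_eq_mul,
    ← Finset.prod_mul_distrib]
  rw [← Finset.prod_pow_eq_pow_sum, ← Finset.prod_mul_distrib]
  simp only [← h']
  rw [Finset.prod_univ_sum, Fintype.piFinset_univ]

theorem pauliString_one (N : ℕ) : pauliString (fun _ : Fin N => Pauli.I) = 1 := by
  ext x y
  have : ∀ a b : Fin 2, Pauli.I.matrix a b = if a = b then 1 else 0 := by
    intro a b; fin_cases a <;> fin_cases b <;> simp [Pauli.matrix]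
  simp only [pauliString, Matrix.of_apply, this, Matrix.one_apply, Finset.prod_ite_zero,
    Finset.prod_const_one, Finset.mem_univ, true_imp_iff, funext_iff]

theorem conjTranspose_pauliString {N : ℕ} (s : Fin N → Pauli) :
    (pauliString s)ᴴ = pauliString s := by
  ext x y
  have : ∀ (p : Pauli) (a b : Fin 2), star (p.matrix b a) = p.matrix a b := by
    intro p a b; cases p <;> fin_cases a <;> fin_cases b <;> simp [Pauli.matrix]
  simp only [Matrix.conjTranspose_apply, pauliString, Matrix.of_apply, star_prod, this]

/-- The `N`-qubit Pauli group: Pauli strings with a phase in `{1, i, -1, -i}`. -/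
def pauliGroup (N : ℕ) : Subgroup (QubitUnitary (Fin N)) where
  carrier := {M | ∃ (k : ℕ) (s : Fin N → Pauli),
    (M : QubitOp (Fin N)) = Complex.I ^ k • pauliString s}
  one_mem' := ⟨0, fun _ => Pauli.I, by simp [pauliString_one]⟩
  mul_mem' := by
    rintro M M' ⟨k, s, h⟩ ⟨k', s', h'⟩
    obtain ⟨l, r, hr⟩ := exists_pauliString_mul s s'
    refine ⟨k + k' + l, r, ?_⟩
    rw [Submonoid.coe_mul, h, h', Matrix.smul_mul, Matrix.mul_smul, hr, smul_smul, smul_smul,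
      pow_add, pow_add, mul_assoc]
  inv_mem' := by
    rintro M ⟨k, s, h⟩
    refine ⟨3 * k, s, ?_⟩
    have h3 : Complex.I ^ 3 = -Complex.I := by
      rw [pow_succ, Complex.I_sq]; ring
    have h1 : ((M⁻¹ : QubitUnitary (Fin N)) : QubitOp (Fin N)) = (M : QubitOp (Fin N))ᴴ := rfl
    rw [h1, h, Matrix.conjTranspose_smul, conjTranspose_pauliString, pow_mul, h3, star_pow]
    simp

/-- The `N`-qubit Clifford group: the unitaries that normalize the Pauli group. -/
def cliffordGroup (N : ℕ) : Subgroup (QubitUnitary (Fin N)) :=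
  Subgroup.normalizer (pauliGroup N : Set (QubitUnitary (Fin N)))

/-! ### Bipartitions, operator Schmidt decompositions and operator entanglement -/

/-- For a set `A` of qubits, with complement `B`, the operator `X ⊗ Y` on all `N` qubits, where
`X` acts on the qubits in `A` and `Y` on those in `B`. -/
def localTensor {N : ℕ} (A : Finset (Fin N)) (X : QubitOp {i // i ∈ A})
    (Y : QubitOp {i // i ∉ A}) : QubitOp (Fin N) :=
  Matrix.of fun x y =>
    X (fun i => x i.1) (fun i => y i.1) * Y (fun i => x i.1) (fun i => y i.1)

/-- An operator Schmidt decomposition `O / √d = ∑ i, √(λ i) V i ⊗ W i`, `d = 2 ^ N`, across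
`A | B`: the `λ i` are positive, and the families `V` and `W` are orthonormal for the
Hilbert--Schmidt scalar product. -/
structure OperatorSchmidt {N : ℕ} (A : Finset (Fin N)) (O : QubitOp (Fin N)) where
  /-- the number of terms -/
  rank : ℕ
  /-- the Schmidt coefficients `λ i` -/
  coeff : Fin rank → ℝ
  /-- the operators `V i` -/
  left : Fin rank → QubitOp {i // i ∈ A}
  /-- the operators `W i` -/
  right : Fin rank → QubitOp {i // i ∉ A}
  coeff_pos : ∀ i, 0 < coeff i
  left_orthonormal : ∀ i j, ((left i)ᴴ * left j).trace = if i = j then 1 else 0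
  right_orthonormal : ∀ i j, ((right i)ᴴ * right j).trace = if i = j then 1 else 0
  expansion : (((√(2 ^ N : ℝ))⁻¹ : ℝ) : ℂ) • O =
    ∑ i, ((√(coeff i) : ℝ) : ℂ) • localTensor A (left i) (right i)

open scoped ComplexOrder in
/-- Singular value decomposition, in the form needed for Schmidt decompositions. -/
theorem exists_schmidt_vectors {m n : Type} [Fintype m] [DecidableEq m] [Fintype n]
    (R : Matrix m n ℂ) :
    ∃ (r : ℕ) (c : Fin r → ℝ) (v : Fin r → m → ℂ) (w : Fin r → n → ℂ),
      (∀ i, 0 < c i) ∧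
      (∀ i j, star (v i) ⬝ᵥ v j = if i = j then 1 else 0) ∧
      (∀ i j, star (w i) ⬝ᵥ w j = if i = j then 1 else 0) ∧
      ∀ x y, R x y = ∑ i, ((√(c i) : ℝ) : ℂ) * (v i x * w i y) := by
  classical
  have hp : (R * Rᴴ).PosSemidef := Matrix.posSemidef_self_mul_conjTranspose R
  have hH : (R * Rᴴ).IsHermitian := hp.isHermitian
  let μ : m → ℝ := hH.eigenvalues
  have hμ : ∀ k, 0 ≤ μ k := hp.eigenvalues_nonneg
  let Q : Matrix m m ℂ := hH.eigenvectorUnitary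
  have hQ : Qᴴ * Q = 1 := Unitary.coe_star_mul_self hH.eigenvectorUnitary
  have hQ' : Q * Qᴴ = 1 := Unitary.coe_mul_star_self hH.eigenvectorUnitary
  let M : Matrix m n ℂ := Qᴴ * R
  have hR : R = Q * M := by
    show R = Q * (Qᴴ * R)
    rw [← Matrix.mul_assoc, hQ', Matrix.one_mul]
  have hspec : R * Rᴴ = Q * Matrix.diagonal (fun k => (μ k : ℂ)) * Qᴴ := by
    have := hH.spectral_theorem
    rw [Unitary.conjStarAlgAut_apply] at this
    exact this
  have hM : M * Mᴴ = Matrix.diagonal (fun k => (μ k : ℂ)) := by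
    show Qᴴ * R * (Qᴴ * R)ᴴ = _
    rw [Matrix.conjTranspose_mul, Matrix.conjTranspose_conjTranspose, Matrix.mul_assoc,
      ← Matrix.mul_assoc R, hspec, Matrix.mul_assoc, hQ, Matrix.mul_one, ← Matrix.mul_assoc, hQ,
      Matrix.one_mul]
  have hMkl : ∀ k l, ∑ y, star (M k y) * M l y = if k = l then (μ k : ℂ) else 0 := by
    intro k l
    have := congrFun (congrFun hM l) k
    simp only [Matrix.mul_apply, Matrix.conjTranspose_apply, Matrix.diagonal_apply] at this
    rw [Finset.sum_congr rfl (fun y _ => mul_comm _ _), this]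
    by_cases h : k = l
    · simp [h]
    · simp [h, Ne.symm h]
  have hM0 : ∀ k, ¬ 0 < μ k → ∀ y, M k y = 0 := by
    intro k hk y
    have h0 : μ k = 0 := le_antisymm (not_lt.mp hk) (hμ k)
    have h := hMkl k k
    simp only [if_true, h0, Complex.ofReal_zero] at h
    have h' : star (M k) ⬝ᵥ M k = 0 := h
    exact congrFun (dotProduct_star_self_eq_zero.mp h') y
  let e : Fin (Fintype.card {k // 0 < μ k}) ≃ {k // 0 < μ k} := (Fintype.equivFin _).symm
  have hs : ∀ i, ((√(μ (e i).1) : ℝ) : ℂ) ≠ 0 := fun i => by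
    exact_mod_cast (Real.sqrt_pos.mpr (e i).2).ne'
  have hs2 : ∀ i, ((√(μ (e i).1) : ℝ) : ℂ) * ((√(μ (e i).1) : ℝ) : ℂ) = (μ (e i).1 : ℂ) :=
    fun i => by exact_mod_cast Real.mul_self_sqrt (hμ _)
  refine ⟨_, fun i => μ (e i).1, fun i x => Q x (e i).1,
    fun i y => (((√(μ (e i).1) : ℝ) : ℂ))⁻¹ * M (e i).1 y, fun i => (e i).2, ?_, ?_, ?_⟩
  · intro i j
    have := congrFun (congrFun hQ (e i).1) (e j).1
    simp only [Matrix.mul_apply, Matrix.conjTranspose_apply, Matrix.one_apply] at this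
    simp only [dotProduct, Pi.star_apply, this, Subtype.val_inj, e.apply_eq_iff_eq]
  · intro i j
    have h := hMkl (e i).1 (e j).1
    have h1 : ∀ y, star ((((√(μ (e i).1) : ℝ) : ℂ))⁻¹ * M (e i).1 y) *
        ((((√(μ (e j).1) : ℝ) : ℂ))⁻¹ * M (e j).1 y) =
        ((((√(μ (e i).1) : ℝ) : ℂ))⁻¹ * (((√(μ (e j).1) : ℝ) : ℂ))⁻¹) *
          (star (M (e i).1 y) * M (e j).1 y) := by
      intro y
      rw [star_mul', star_inv₀, Complex.star_def, Complex.conj_ofReal]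
      ring
    simp only [dotProduct, Pi.star_apply, h1, ← Finset.mul_sum, h, Subtype.val_inj,
      e.apply_eq_iff_eq]
    by_cases hij : i = j
    · subst hij
      simp only [if_true, ← hs2]
      field_simp [hs i]
    · simp [hij]
  · intro x y
    have h1 : R x y = ∑ k, Q x k * M k y := by
      conv_lhs => rw [hR]
      rfl
    have h2 : ∀ i, ((√(μ (e i).1) : ℝ) : ℂ) *
        (Q x (e i).1 * ((((√(μ (e i).1) : ℝ) : ℂ))⁻¹ * M (e i).1 y)) =
        Q x (e i).1 * M (e i).1 y := by
      intro i
      have := hs i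
      field_simp
    rw [h1, Finset.sum_congr rfl (fun i _ => h2 i),
      e.sum_comp (fun k => Q x k.1 * M k.1 y)]
    rw [← Finset.sum_subtype (Finset.univ.filter fun k => 0 < μ k) (by simp)
      (fun k => Q x k * M k y)]
    symm
    apply Finset.sum_subset (Finset.filter_subset _ _)
    intro k _ hk
    rw [hM0 k (by simpa using hk), mul_zero]

/-- The positive coefficients of a singular value decomposition determine, and are determined
by, the characteristic polynomial of `R * Rᴴ`; their sum is its trace. -/
theorem schmidt_vectors_spec {m n : Type} [Fintype m] [DecidableEq m] [Fintype n]
    {R : Matrix m n ℂ} {r : ℕ} {c : Fin r → ℝ} {v : Fin r → m → ℂ} {w : Fin r → n → ℂ}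
    (hc : ∀ i, 0 < c i) (hv : ∀ i j, star (v i) ⬝ᵥ v j = if i = j then 1 else 0)
    (hw : ∀ i j, star (w i) ⬝ᵥ w j = if i = j then 1 else 0)
    (hR : ∀ x y, R x y = ∑ i, ((√(c i) : ℝ) : ℂ) * (v i x * w i y)) :
    (R * Rᴴ).charpoly.roots.filter (· ≠ 0) = Finset.univ.val.map (fun i => (c i : ℂ)) ∧
      (R * Rᴴ).trace = ∑ i, (c i : ℂ) := by
  classical
  let V : Matrix m (Fin r) ℂ := Matrix.of fun x i => v i x
  let W : Matrix (Fin r) n ℂ := Matrix.of fun i y => w i y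
  let D : Matrix (Fin r) (Fin r) ℂ := Matrix.diagonal fun i => ((√(c i) : ℝ) : ℂ)
  let D2 : Matrix (Fin r) (Fin r) ℂ := Matrix.diagonal fun i => (c i : ℂ)
  have hV : Vᴴ * V = 1 := by
    ext i j
    rw [Matrix.one_apply, ← hv i j]
    rfl
  have hW : W * Wᴴ = 1 := by
    ext i j
    rw [Matrix.one_apply]
    have := hw j i
    rw [dotProduct_comm] at this
    refine Eq.trans this ?_
    simp [eq_comm]
  have hD : D * Dᴴ = D2 := by
    simp only [D, D2, Matrix.diagonal_conjTranspose, Matrix.diagonal_mul_diagonal]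
    congr 1
    ext i
    simp only [Pi.star_apply, Complex.star_def, Complex.conj_ofReal]
    exact_mod_cast Real.mul_self_sqrt (hc i).le
  have hRVW : R = V * D * W := by
    ext x y
    rw [hR, Matrix.mul_apply]
    refine Finset.sum_congr rfl fun i _ => ?_
    simp only [V, D, W, Matrix.mul_diagonal, Matrix.of_apply]
    ring
  have hRR : R * Rᴴ = V * (D2 * Vᴴ) := by
    rw [hRVW, Matrix.conjTranspose_mul, Matrix.conjTranspose_mul, Matrix.mul_assoc (V * D),
      ← Matrix.mul_assoc W, hW, Matrix.one_mul, Matrix.mul_assoc, ← Matrix.mul_assoc D, hD]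
  have hDV : D2 * Vᴴ * V = D2 := by rw [Matrix.mul_assoc, hV, Matrix.mul_one]
  constructor
  · have h := Matrix.charpoly_mul_comm' V (D2 * Vᴴ)
    rw [← hRR, hDV] at h
    have hroots := congrArg Polynomial.roots h
    rw [Polynomial.roots_mul (mul_ne_zero (pow_ne_zero _ Polynomial.X_ne_zero)
        (Matrix.charpoly_monic _).ne_zero),
      Polynomial.roots_mul (mul_ne_zero (pow_ne_zero _ Polynomial.X_ne_zero)
        (Matrix.charpoly_monic _).ne_zero), Polynomial.roots_X_pow, Polynomial.roots_X_pow] at hroots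
    have hD2 : D2.charpoly.roots = Finset.univ.val.map (fun i => (c i : ℂ)) := by
      rw [Matrix.charpoly_diagonal, Polynomial.roots_prod]
      · simp
      · exact Finset.prod_ne_zero_iff.mpr fun i _ => Polynomial.X_sub_C_ne_zero _
    rw [hD2] at hroots
    have hf := congrArg (Multiset.filter (· ≠ 0)) hroots
    rw [Multiset.filter_add, Multiset.filter_add] at hf
    have hz : ∀ k : ℕ, Multiset.filter (· ≠ 0) (k • ({0} : Multiset ℂ)) = 0 := by
      intro k
      rw [Multiset.filter_eq_nil]
      intro a ha
      have := Multiset.mem_of_mem_nsmul ha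
      simpa using this
    rw [hz, hz, zero_add, zero_add] at hf
    rw [hf, Multiset.filter_eq_self]
    intro a ha
    obtain ⟨i, -, rfl⟩ := Multiset.mem_map.mp ha
    exact_mod_cast (hc i).ne'
  · rw [hRR, Matrix.trace_mul_comm, hDV, Matrix.trace_diagonal]

/-- The identification of the `N`-qubit basis with pairs of basis states of `A` and of `B`. -/
def splitBasis {N : ℕ} (A : Finset (Fin N)) :
    QubitBasis (Fin N) ≃ QubitBasis {i // i ∈ A} × QubitBasis {i // i ∉ A} :=
  Equiv.piEquivPiSubtypeProd (fun i => i ∈ A) (fun _ => Fin 2)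

/-- The matrix `O / √d` with its entries rearranged into a matrix between operators on `A` and
operators on `B`. -/
def realign {N : ℕ} (A : Finset (Fin N)) (O : QubitOp (Fin N)) :
    Matrix (QubitBasis {i // i ∈ A} × QubitBasis {i // i ∈ A})
      (QubitBasis {i // i ∉ A} × QubitBasis {i // i ∉ A}) ℂ :=
  Matrix.of fun a b => (((√(2 ^ N : ℝ))⁻¹ : ℝ) : ℂ) *
    O ((splitBasis A).symm (a.1, b.1)) ((splitBasis A).symm (a.2, b.2))

theorem trace_conjTranspose_mul_eq {κ : Type} [Fintype κ] (X Y : Matrix κ κ ℂ) :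
    (Xᴴ * Y).trace = star (fun a : κ × κ => X a.1 a.2) ⬝ᵥ (fun a : κ × κ => Y a.1 a.2) := by
  simp only [Matrix.trace, Matrix.diag, Matrix.mul_apply, Matrix.conjTranspose_apply, dotProduct,
    Pi.star_apply, Fintype.sum_prod_type]
  exact Finset.sum_comm

theorem localTensor_splitBasis_symm {N : ℕ} (A : Finset (Fin N)) (X : QubitOp {i // i ∈ A})
    (Y : QubitOp {i // i ∉ A}) (a a' : QubitBasis {i // i ∈ A}) (b b' : QubitBasis {i // i ∉ A}) :
    localTensor A X Y ((splitBasis A).symm (a, b)) ((splitBasis A).symm (a', b')) =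
      X a a' * Y b b' := by
  have h1 := (splitBasis A).apply_symm_apply (a, b)
  have h2 := (splitBasis A).apply_symm_apply (a', b')
  have h1a := congrArg Prod.fst h1
  have h1b := congrArg Prod.snd h1
  have h2a := congrArg Prod.fst h2
  have h2b := congrArg Prod.snd h2
  show X (splitBasis A ((splitBasis A).symm (a, b))).1
      (splitBasis A ((splitBasis A).symm (a', b'))).1 *
    Y (splitBasis A ((splitBasis A).symm (a, b))).2
      (splitBasis A ((splitBasis A).symm (a', b'))).2 = _
  rw [h1a, h1b, h2a, h2b]

/-- Every operator has an operator Schmidt decomposition. -/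
theorem OperatorSchmidt.exists_decomposition {N : ℕ} (A : Finset (Fin N)) (O : QubitOp (Fin N)) :
    Nonempty (OperatorSchmidt A O) := by
  obtain ⟨r, c, v, w, hc, hv, hw, hR⟩ := exists_schmidt_vectors (realign A O)
  refine ⟨⟨r, c, fun i => Matrix.of fun a a' => v i (a, a'),
    fun i => Matrix.of fun b b' => w i (b, b'), hc, ?_, ?_, ?_⟩⟩
  · intro i j
    rw [trace_conjTranspose_mul_eq, ← hv i j]
    rfl
  · intro i j
    rw [trace_conjTranspose_mul_eq, ← hw i j]
    rfl
  · ext x y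
    obtain ⟨⟨a, b⟩, rfl⟩ := (splitBasis A).symm.surjective x
    obtain ⟨⟨a', b'⟩, rfl⟩ := (splitBasis A).symm.surjective y
    simp only [Matrix.smul_apply, Matrix.sum_apply, localTensor_splitBasis_symm, smul_eq_mul,
      Matrix.of_apply]
    exact hR (a, a') (b, b')

theorem OperatorSchmidt.realign_apply {N : ℕ} {A : Finset (Fin N)} {O : QubitOp (Fin N)}
    (D : OperatorSchmidt A O) (x : QubitBasis {i // i ∈ A} × QubitBasis {i // i ∈ A})
    (y : QubitBasis {i // i ∉ A} × QubitBasis {i // i ∉ A}) :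
    realign A O x y =
      ∑ i, ((√(D.coeff i) : ℝ) : ℂ) * (D.left i x.1 x.2 * D.right i y.1 y.2) := by
  have h := congrFun (congrFun D.expansion ((splitBasis A).symm (x.1, y.1)))
    ((splitBasis A).symm (x.2, y.2))
  simp only [Matrix.smul_apply, Matrix.sum_apply, localTensor_splitBasis_symm,
    smul_eq_mul] at h
  exact h

theorem OperatorSchmidt.coeff_spec {N : ℕ} {A : Finset (Fin N)} {O : QubitOp (Fin N)}
    (D : OperatorSchmidt A O) :
    (realign A O * (realign A O)ᴴ).charpoly.roots.filter (· ≠ 0) =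
        Finset.univ.val.map (fun i => (D.coeff i : ℂ)) ∧
      (realign A O * (realign A O)ᴴ).trace = ∑ i, (D.coeff i : ℂ) :=
  schmidt_vectors_spec (v := fun i a => D.left i a.1 a.2) (w := fun i b => D.right i b.1 b.2)
    D.coeff_pos
    (fun i j => by rw [← trace_conjTranspose_mul_eq]; exact D.left_orthonormal i j)
    (fun i j => by rw [← trace_conjTranspose_mul_eq]; exact D.right_orthonormal i j)
    D.realign_apply

/-- The multiset of Schmidt coefficients does not depend on the decomposition. -/
theorem OperatorSchmidt.coeff_unique {N : ℕ} {A : Finset (Fin N)} {O : QubitOp (Fin N)}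
    (D D' : OperatorSchmidt A O) :
    (Finset.univ.val.map D.coeff : Multiset ℝ) = Finset.univ.val.map D'.coeff := by
  have h := D.coeff_spec.1.symm.trans D'.coeff_spec.1
  have h' := congrArg (Multiset.map Complex.re) h
  simpa only [Multiset.map_map, Function.comp_def, Complex.ofReal_re] using h'

/-- For a unitary operator the Schmidt coefficients form a probability distribution. -/
theorem OperatorSchmidt.sum_coeff {N : ℕ} {A : Finset (Fin N)} {O : QubitOp (Fin N)}
    (D : OperatorSchmidt A O) (hO : O ∈ Matrix.unitaryGroup (QubitBasis (Fin N)) ℂ) :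
    ∑ i, D.coeff i = 1 := by
  have h := D.coeff_spec.2
  have hd : (((√(2 ^ N : ℝ))⁻¹ : ℝ) : ℂ) * (((√(2 ^ N : ℝ))⁻¹ : ℝ) : ℂ) = ((2 : ℂ) ^ N)⁻¹ := by
    rw [← Complex.ofReal_mul, ← mul_inv, Real.mul_self_sqrt (by positivity)]
    push_cast
    rfl
  have ht : (realign A O * (realign A O)ᴴ).trace = ((2 : ℂ) ^ N)⁻¹ * (O * Oᴴ).trace := by
    simp only [Matrix.trace, Matrix.diag, Matrix.mul_apply, Matrix.conjTranspose_apply, realign,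
      Matrix.of_apply, Finset.mul_sum]
    simp only [← (splitBasis A).symm.sum_comp, Fintype.sum_prod_type]
    refine Finset.sum_congr rfl fun a _ => ?_
    rw [Finset.sum_comm]
    refine Finset.sum_congr rfl fun b _ => Finset.sum_congr rfl fun a' _ =>
      Finset.sum_congr rfl fun b' _ => ?_
    rw [star_mul', Complex.star_def, Complex.conj_ofReal, ← hd]
    ring
  have hO' : O * Oᴴ = 1 := Matrix.mem_unitaryGroup_iff.mp hO
  rw [ht, hO', Matrix.trace_one] at h
  have hcard : Fintype.card (QubitBasis (Fin N)) = 2 ^ N := by simp [QubitBasis]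
  rw [hcard] at h
  push_cast at h
  rw [inv_mul_cancel₀ (pow_ne_zero _ two_ne_zero)] at h
  exact_mod_cast h.symm

/-- The entropic measures of finite probability distributions: the Rényi entropies of all orders
in `[0, ∞]`, the linear entropy, and every entropy `∑ i, f (p i)` given by a strictly concave
`f` on `[0, 1]` with `f 0 = f 1 = 0` (Shannon, Tsallis, …). -/
inductive EntropicMeasure : Type
  | renyi (α : ℝ≥0∞)
  | linear
  | concave (f : ℝ → ℝ) (hf : StrictConcaveOn ℝ (Set.Icc 0 1) f) (h0 : f 0 = 0) (h1 : f 1 = 0)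

/-- The Rényi entropy of order `α ∈ [0, ∞]` of a distribution with positive weights: Shannon
entropy for `α = 1`, min-entropy for `α = ∞`. -/
def renyiEntropy (α : ℝ≥0∞) {r : ℕ} (p : Fin r → ℝ) : ℝ :=
  if α = 1 then -∑ i, p i * Real.log (p i)
  else if α = ∞ then -Real.log (⨆ i, p i)
  else 1 / (1 - α.toReal) * Real.log (∑ i, p i ^ α.toReal)

/-- The value of an entropic measure on a distribution with positive weights. -/
def EntropicMeasure.eval (S : EntropicMeasure) {r : ℕ} (p : Fin r → ℝ) : ℝ :=
  match S with
  | .renyi α => renyiEntropy α p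
  | .linear => 1 - ∑ i, p i ^ 2
  | .concave f _ _ _ => ∑ i, f (p i)

/-- The operator entanglement `E(O)` across `A | B` of an operator `O`, quantified by the entropic
measure `S`: the entropy of the Schmidt coefficients of `O`. -/
def operatorEntanglement {N : ℕ} (S : EntropicMeasure) (A : Finset (Fin N))
    (O : QubitOp (Fin N)) : ℝ :=
  S.eval (Classical.choice (OperatorSchmidt.exists_decomposition A O)).coeff

/-- The operator entanglement can be computed from any operator Schmidt decomposition. -/
theorem operatorEntanglement_eq {N : ℕ} (S : EntropicMeasure) {A : Finset (Fin N)}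
    {O : QubitOp (Fin N)} (D : OperatorSchmidt A O) :
    operatorEntanglement S A O = S.eval D.coeff := by
  set D' := Classical.choice (OperatorSchmidt.exists_decomposition A O) with hD'
  have h := D'.coeff_unique D
  have hsum : ∀ f : ℝ → ℝ, ∑ i, f (D'.coeff i) = ∑ i, f (D.coeff i) := by
    intro f
    have := congrArg (fun M : Multiset ℝ => (M.map f).sum) h
    simp only [Multiset.map_map, Function.comp_def] at this
    exact this
  have hrange : Set.range D'.coeff = Set.range D.coeff := by
    ext x
    have := congrArg (fun M : Multiset ℝ => x ∈ M) h
    simpa using this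
  show S.eval D'.coeff = S.eval D.coeff
  cases S with
  | renyi α =>
    simp only [EntropicMeasure.eval, renyiEntropy, iSup, hrange,
      hsum fun x => x * Real.log x, hsum fun x => x ^ α.toReal]
  | linear => simp only [EntropicMeasure.eval, hsum fun x => x ^ 2]
  | concave f _ _ _ => simp only [EntropicMeasure.eval, hsum f]

end

/-! If `U† = (V ⊗ W) C`, then `C` sends a Pauli string to a phase times a Pauli string, which is a
product across `A | B`, and conjugation by `V ⊗ W` keeps it a product of unitaries. Such an operator
has a single Schmidt coefficient, equal to 1, so every entropy vanishes
(`operatorEntanglement_localTensor_eq_zero`).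

Conversely, each admissible entropy vanishes only when there is a single Schmidt coefficient, so
every `U† P U` is a product `a ⊗ b`, with `a` and `b` unitary after rescaling
(`exists_unitary_factors`). The operators `a` so obtained, with all phases allowed, form a monoid on
`A`. Since Pauli strings square to 1 and commute up to a sign, elements of this monoid square to
scalars and commute up to scalars. The monoid is irreducible: if `M` commutes with it, then `M ⊗ 1`
commutes with every `U† P U`, hence is a scalar.

The core is that such a monoid `G` is a Pauli group in disguise (`IsPauliLike.exists_unitary`). Take
a largest family of pairs `x i`, `z i` in `G` obeying the relations of single-site `X` and `Z`. Two
elements that commute with the family must commute with each other, since otherwise they would give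
one more pair. Every element of `G` can be multiplied by a product of family members so as to
commute with the family; it then commutes with all of `G` and is a scalar. A joint eigenvector of
the `z i` generates an isometric copy of the qubit representation; its range projection commutes
with `G`, so it is 1. Counting dimensions, there is one pair per qubit and the isometry is a unitary
taking `G` to multiples of Pauli strings.

Applied to both sides, this gives `V` and `W`, and `C = (V ⊗ W)† U†` sends Pauli strings to
multiples of Pauli strings. Hermiticity and finiteness of the Pauli group then make `C` Clifford
(`mem_cliffordGroup_of_forall`). -/

/-! ### Product operators and single-site Pauli operators -/

section Product

set_option linter.unusedSectionVars false

variable {ι : Type} [Fintype ι] [DecidableEq ι]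

/-- The tensor product over `ι` of single-qubit operators. -/
def tensorOp (m : ι → Matrix (Fin 2) (Fin 2) ℂ) : QubitOp ι :=
  Matrix.of fun x y => ∏ i, m i (x i) (y i)

/-- Pauli strings on an arbitrary finite family of qubits. -/
def pauliOp (s : ι → Pauli) : QubitOp ι := tensorOp fun i => (s i).matrix

/-- The operator `M` on the qubit `i`, tensored with the identity. -/
def siteOp (i : ι) (M : Matrix (Fin 2) (Fin 2) ℂ) : QubitOp ι :=
  tensorOp (Function.update 1 i M)

theorem tensorOp_mul (m m' : ι → Matrix (Fin 2) (Fin 2) ℂ) :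
    tensorOp m * tensorOp m' = tensorOp (m * m') := by
  ext x y
  simp only [tensorOp, Matrix.mul_apply, Matrix.of_apply, ← Finset.prod_mul_distrib, Pi.mul_apply]
  rw [Finset.prod_univ_sum, Fintype.piFinset_univ]

theorem tensorOp_one : tensorOp (1 : ι → Matrix (Fin 2) (Fin 2) ℂ) = 1 := by
  ext x y
  simp only [tensorOp, Matrix.of_apply, Pi.one_apply, Matrix.one_apply, Finset.prod_ite_zero,
    Finset.prod_const_one, Finset.mem_univ, true_imp_iff, funext_iff]

theorem tensorOp_update_smul (m : ι → Matrix (Fin 2) (Fin 2) ℂ) (i : ι) (c : ℂ)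
    (M : Matrix (Fin 2) (Fin 2) ℂ) :
    tensorOp (Function.update m i (c • M)) = c • tensorOp (Function.update m i M) := by
  ext x y
  simp only [tensorOp, Matrix.of_apply, Matrix.smul_apply, smul_eq_mul]
  rw [← Finset.mul_prod_erase _ _ (Finset.mem_univ i),
    ← Finset.mul_prod_erase (a := i) (f := fun j => Function.update m i M j (x j) (y j)) _
      (Finset.mem_univ i), ← mul_assoc]
  congr 1
  · simp
  · refine Finset.prod_congr rfl fun j hj => ?_
    rw [Function.update_of_ne (Finset.ne_of_mem_erase hj),
      Function.update_of_ne (Finset.ne_of_mem_erase hj)]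

theorem tensorOp_mul_siteOp (m : ι → Matrix (Fin 2) (Fin 2) ℂ) (i : ι)
    (M : Matrix (Fin 2) (Fin 2) ℂ) :
    tensorOp m * siteOp i M = tensorOp (Function.update m i (m i * M)) := by
  rw [siteOp, tensorOp_mul]
  congr 1
  ext1 j
  by_cases h : j = i
  · subst h; simp
  · simp [h]

theorem siteOp_mul_tensorOp (m : ι → Matrix (Fin 2) (Fin 2) ℂ) (i : ι)
    (M : Matrix (Fin 2) (Fin 2) ℂ) :
    siteOp i M * tensorOp m = tensorOp (Function.update m i (M * m i)) := by
  rw [siteOp, tensorOp_mul]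
  congr 1
  ext1 j
  by_cases h : j = i
  · subst h; simp
  · simp [h]

theorem tensorOp_mul_siteOp_of_eq_smul {m : ι → Matrix (Fin 2) (Fin 2) ℂ} {i : ι}
    {M : Matrix (Fin 2) (Fin 2) ℂ} {c : ℂ} (h : m i * M = c • (M * m i)) :
    tensorOp m * siteOp i M = c • (siteOp i M * tensorOp m) := by
  rw [tensorOp_mul_siteOp, siteOp_mul_tensorOp, h, tensorOp_update_smul]

theorem Pauli.matrix_I : Pauli.I.matrix = 1 := by
  ext i j; fin_cases i <;> fin_cases j <;> simp [Pauli.matrix]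

theorem Pauli.matrix_mul_self (p : Pauli) : p.matrix * p.matrix = 1 := by
  cases p <;> ext i j <;> fin_cases i <;> fin_cases j <;> simp [Pauli.matrix]

theorem pauliOp_mul_self (s : ι → Pauli) : pauliOp s * pauliOp s = 1 := by
  rw [pauliOp, tensorOp_mul, ← tensorOp_one]
  congr 1
  ext1 i
  exact (s i).matrix_mul_self

theorem conjTranspose_pauliOp (s : ι → Pauli) : (pauliOp s)ᴴ = pauliOp s := by
  ext x y
  have : ∀ (p : Pauli) (a b : Fin 2), star (p.matrix b a) = p.matrix a b := by
    intro p a b; cases p <;> fin_cases a <;> fin_cases b <;> simp [Pauli.matrix]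
  simp only [Matrix.conjTranspose_apply, pauliOp, tensorOp, Matrix.of_apply, star_prod, this]

theorem siteOp_pauli (i : ι) (p : Pauli) :
    siteOp i p.matrix = pauliOp (Function.update (fun _ => Pauli.I) i p) := by
  rw [siteOp, pauliOp]
  congr 1
  ext1 j
  by_cases h : j = i
  · subst h; simp
  · simp [h, Pauli.matrix_I]

/-- The basis state with the qubit `i` flipped. -/
def flipBit (i : ι) (x : QubitBasis ι) : QubitBasis ι := Function.update x i (x i + 1)

theorem flipBit_flipBit (i : ι) (x : QubitBasis ι) : flipBit i (flipBit i x) = x := by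
  have : ∀ a : Fin 2, a + 1 + 1 = a := by decide
  simp [flipBit, this]

theorem siteOp_X_apply (i : ι) (x y : QubitBasis ι) :
    siteOp i Pauli.X.matrix x y = if x = flipBit i y then 1 else 0 := by
  have h0 : ∀ a b : Fin 2, Pauli.X.matrix a b = if a = b + 1 then 1 else 0 := by
    intro a b; fin_cases a <;> fin_cases b <;> simp [Pauli.matrix]
  have h : ∀ j, Function.update (1 : ι → Matrix (Fin 2) (Fin 2) ℂ) i Pauli.X.matrix j (x j) (y j)
      = if x j = flipBit i y j then 1 else 0 := by
    intro j
    by_cases hj : j = i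
    · subst hj; simp [flipBit, h0]
    · simp [flipBit, hj, Matrix.one_apply]
  simp only [siteOp, tensorOp, Matrix.of_apply, h, Finset.prod_ite_zero,
    Finset.prod_const_one, Finset.mem_univ, true_imp_iff, funext_iff]

theorem siteOp_Z_eq (i : ι) :
    siteOp i Pauli.Z.matrix = Matrix.diagonal fun x : QubitBasis ι => (-1 : ℂ) ^ (x i).val := by
  have h0 : ∀ a b : Fin 2, Pauli.Z.matrix a b = if a = b then (-1) ^ a.val else 0 := by
    intro a b; fin_cases a <;> fin_cases b <;> simp [Pauli.matrix]
  ext x y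
  have h : ∀ j, Function.update (1 : ι → Matrix (Fin 2) (Fin 2) ℂ) i Pauli.Z.matrix j (x j) (y j)
      = if x j = y j then (if j = i then (-1) ^ (x i).val else 1) else 0 := by
    intro j
    by_cases hj : j = i
    · subst hj; simp [h0]
    · simp [hj, Matrix.one_apply]
  simp only [siteOp, tensorOp, Matrix.of_apply, h, Finset.prod_ite_zero, Finset.mem_univ,
    true_imp_iff, Finset.prod_ite_eq', if_true, Matrix.diagonal_apply, funext_iff]

theorem mul_siteOp_X_apply {κ : Type} (M : Matrix κ (QubitBasis ι) ℂ) (i : ι) (x : κ)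
    (y : QubitBasis ι) : (M * siteOp i Pauli.X.matrix) x y = M x (flipBit i y) := by
  simp [Matrix.mul_apply, siteOp_X_apply]

theorem siteOp_X_mul_apply {κ : Type} (M : Matrix (QubitBasis ι) κ ℂ) (i : ι) (x : QubitBasis ι)
    (y : κ) : (siteOp i Pauli.X.matrix * M) x y = M (flipBit i x) y := by
  have h : ∀ w, x = flipBit i w ↔ flipBit i x = w := fun w =>
    ⟨fun h => by rw [h, flipBit_flipBit], fun h => by rw [← h, flipBit_flipBit]⟩
  simp [Matrix.mul_apply, siteOp_X_apply, h]

/-- Any basis state is reached from 0 by flipping bits one at a time; `s.piecewise x 0` is the state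
after the bits in `s` have been treated. -/
theorem eq_of_flipBit_invariant {f : QubitBasis ι → ℂ} (h : ∀ i x, f (flipBit i x) = f x)
    (x : QubitBasis ι) : f x = f 0 := by
  have key : ∀ s : Finset ι, f (s.piecewise x 0) = f 0 := by
    intro s
    induction s using Finset.induction_on with
    | empty => simp
    | insert i s hi ih =>
      rw [Finset.piecewise_insert, ← ih]
      have h2 : ∀ a : Fin 2, a = 0 ∨ a = 0 + 1 := by decide
      have hs : s.piecewise x 0 i = 0 := by simp [hi]
      rcases h2 (x i) with hx | hx
      · rw [hx, ← hs, Function.update_eq_self]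
      · rw [hx, ← hs]
        exact h i _
  simpa using key Finset.univ

/-- Operators commuting with all single-site `X` and `Z` are scalars. -/
theorem eq_smul_one_of_commute_siteOp {M : QubitOp ι}
    (hX : ∀ i, M * siteOp i Pauli.X.matrix = siteOp i Pauli.X.matrix * M)
    (hZ : ∀ i, M * siteOp i Pauli.Z.matrix = siteOp i Pauli.Z.matrix * M) :
    ∃ c : ℂ, M = c • 1 := by
  refine ⟨M 0 0, ?_⟩
  -- The `X` relations make the diagonal constant; the `Z` relation at a bit where `x` and `y`
  -- differ kills the off-diagonal entry.
  have hdiag : ∀ x, M x x = M 0 0 := by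
    refine eq_of_flipBit_invariant (f := fun x => M x x) fun i x => ?_
    have h := congrFun (congrFun (hX i) x) (flipBit i x)
    rw [mul_siteOp_X_apply, siteOp_X_mul_apply, flipBit_flipBit] at h
    exact h.symm
  ext x y
  by_cases hxy : x = y
  · subst hxy; simp [hdiag]
  · obtain ⟨i, hi⟩ := Function.ne_iff.mp hxy
    have h := congrFun (congrFun (hZ i) x) y
    rw [siteOp_Z_eq, Matrix.mul_diagonal, Matrix.diagonal_mul] at h
    have hne : ∀ a b : Fin 2, a ≠ b → ∀ c : ℂ, c * (-1) ^ b.val = (-1) ^ a.val * c → c = 0 := by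
      intro a b hab c hc
      fin_cases a <;> fin_cases b <;> simp at hab hc ⊢
      · exact self_eq_neg.mp hc.symm
      · exact self_eq_neg.mp hc
    simp [hxy, hne _ _ hi _ h]

/-- The four sign patterns against `X` and `Z` correspond to the four Pauli matrices. -/
theorem exists_pauli_commutation {ε δ : ℂ} (hε : ε = 1 ∨ ε = -1) (hδ : δ = 1 ∨ δ = -1) :
    ∃ p : Pauli, p.matrix * Pauli.X.matrix = ε • (Pauli.X.matrix * p.matrix) ∧
      p.matrix * Pauli.Z.matrix = δ • (Pauli.Z.matrix * p.matrix) := by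
  rcases hε with rfl | rfl <;> rcases hδ with rfl | rfl
  · exact ⟨.I, by simp [Pauli.matrix_I], by simp [Pauli.matrix_I]⟩
  · exact ⟨.X, by simp, by simp [Pauli.matrix]⟩
  · exact ⟨.Z, by simp [Pauli.matrix], by simp⟩
  · exact ⟨.Y, by simp [Pauli.matrix], by simp [Pauli.matrix]⟩

/-- An operator that commutes or anticommutes with every single-site `X` and `Z` is proportional
to a Pauli string. -/
theorem exists_eq_smul_pauliOp {M : QubitOp ι} {ε δ : ι → ℂ} (hε : ∀ i, ε i = 1 ∨ ε i = -1)
    (hδ : ∀ i, δ i = 1 ∨ δ i = -1)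
    (hX : ∀ i, M * siteOp i Pauli.X.matrix = ε i • (siteOp i Pauli.X.matrix * M))
    (hZ : ∀ i, M * siteOp i Pauli.Z.matrix = δ i • (siteOp i Pauli.Z.matrix * M)) :
    ∃ (c : ℂ) (s : ι → Pauli), M = c • pauliOp s := by
  choose s hsX hsZ using fun i => exists_pauli_commutation (hε i) (hδ i)
  have hsq : ∀ e : ℂ, e = 1 ∨ e = -1 → e * e = 1 := by
    rintro e (rfl | rfl) <;> norm_num
  -- `pauliOp s` has the same signs as `M`, so the signs cancel in the product and `pauliOp s * M`
  -- is a scalar.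
  have key : ∀ (e : ℂ) (S : QubitOp ι), e * e = 1 → M * S = e • (S * M) →
      pauliOp s * S = e • (S * pauliOp s) → pauliOp s * M * S = S * (pauliOp s * M) := by
    intro e S he h1 h2
    rw [Matrix.mul_assoc, h1, Matrix.mul_smul, ← Matrix.mul_assoc, h2, Matrix.smul_mul, smul_smul,
      he, one_smul, Matrix.mul_assoc]
  obtain ⟨c, hc⟩ := eq_smul_one_of_commute_siteOp (M := pauliOp s * M)
    (fun i => key _ _ (hsq _ (hε i)) (hX i) (tensorOp_mul_siteOp_of_eq_smul (hsX i)))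
    (fun i => key _ _ (hsq _ (hδ i)) (hZ i) (tensorOp_mul_siteOp_of_eq_smul (hsZ i)))
  refine ⟨c, s, ?_⟩
  rw [← Matrix.one_mul M, ← pauliOp_mul_self s, Matrix.mul_assoc, hc, Matrix.mul_smul,
    Matrix.mul_one]

end Product

/-! ### Representations of the Pauli relations -/

/-- Hermitian involutions `x i`, `z i` with the commutation relations of single-site `X` and `Z`. -/
structure PauliRelations {α κ : Type} [Fintype κ] [DecidableEq κ]
    (x z : α → Matrix κ κ ℂ) : Prop where
  x_conj : ∀ i, (x i)ᴴ = x i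
  z_conj : ∀ i, (z i)ᴴ = z i
  x_sq : ∀ i, x i * x i = 1
  z_sq : ∀ i, z i * z i = 1
  x_comm : ∀ i j, x i * x j = x j * x i
  z_comm : ∀ i j, z i * z j = z j * z i
  xz_comm : ∀ i j, i ≠ j → z i * x j = x j * z i
  xz_anti : ∀ i, z i * x i = -(x i * z i)

namespace PauliRelations

variable {α κ : Type} [Fintype κ] [DecidableEq κ] {x z : α → Matrix κ κ ℂ}

/-- If `v + z j v` is nonzero, it is fixed by `z j`. Otherwise `z j v = -v`, and `x j v` is fixed
because `x j` anticommutes with `z j`; the other `z i` commute with both `x j` and `z j`, so earlier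
eigenvalues survive. -/
theorem exists_joint_eigenvector [Nonempty κ] (h : PauliRelations x z) (s : Finset α) :
    ∃ v : κ → ℂ, v ≠ 0 ∧ ∀ i ∈ s, z i *ᵥ v = v := by
  classical
  induction s using Finset.induction_on with
  | empty => exact ⟨fun _ => 1, fun h => by simpa using congrFun h (Classical.arbitrary κ), by simp⟩
  | insert j s hj ih =>
    obtain ⟨v, hv, hs⟩ := ih
    by_cases h0 : v + z j *ᵥ v = 0
    · refine ⟨x j *ᵥ v, fun hx => hv ?_, fun i hi => ?_⟩
      · rw [← Matrix.one_mulVec v, ← h.x_sq j, ← Matrix.mulVec_mulVec, hx, Matrix.mulVec_zero]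
      · rcases Finset.mem_insert.mp hi with rfl | hi'
        · rw [Matrix.mulVec_mulVec, h.xz_anti, Matrix.neg_mulVec, ← Matrix.mulVec_mulVec,
            ← Matrix.mulVec_neg, ← eq_neg_of_add_eq_zero_left h0]
        · have hij : i ≠ j := fun e => hj (e ▸ hi')
          rw [Matrix.mulVec_mulVec, h.xz_comm i j hij, ← Matrix.mulVec_mulVec, hs i hi']
    · refine ⟨_, h0, fun i hi => ?_⟩
      rcases Finset.mem_insert.mp hi with rfl | hi'
      · rw [Matrix.mulVec_add, Matrix.mulVec_mulVec, h.z_sq, Matrix.one_mulVec, add_comm]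
      · rw [Matrix.mulVec_add, Matrix.mulVec_mulVec, h.z_comm, ← Matrix.mulVec_mulVec, hs i hi']

open scoped ComplexOrder in
theorem exists_unit_joint_eigenvector [Fintype α] [Nonempty κ] (h : PauliRelations x z) :
    ∃ v : κ → ℂ, star v ⬝ᵥ v = 1 ∧ ∀ i, z i *ᵥ v = v := by
  obtain ⟨v, hv, hz⟩ := h.exists_joint_eigenvector Finset.univ
  have hpos : 0 < star v ⬝ᵥ v := Matrix.dotProduct_star_self_pos_iff.mpr hv
  obtain ⟨hre, him⟩ := Complex.lt_def.mp hpos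
  set r : ℝ := (star v ⬝ᵥ v).re with hr
  have hvr : star v ⬝ᵥ v = (r : ℂ) := Complex.ext (by simp [hr]) (by simpa using him.symm)
  have hr0 : 0 < r := by simpa using hre
  refine ⟨(((√r)⁻¹ : ℝ) : ℂ) • v, ?_, fun i => by rw [Matrix.mulVec_smul, hz i (Finset.mem_univ i)]⟩
  rw [star_smul, smul_dotProduct, dotProduct_smul, hvr, Complex.star_def, Complex.conj_ofReal]
  simp only [smul_eq_mul, ← Complex.ofReal_mul]
  have : (√r)⁻¹ * ((√r)⁻¹ * r) = 1 := by
    have h2 := Real.mul_self_sqrt hr0.le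
    have h3 : √r ≠ 0 := (Real.sqrt_pos.mpr hr0).ne'
    field_simp
    linarith [Real.sq_sqrt hr0.le]
  rw [this, Complex.ofReal_one]

theorem dotProduct_mulVec_self {M : Matrix κ κ ℂ} (hM : Mᴴ * M = 1) (v : κ → ℂ) :
    star (M *ᵥ v) ⬝ᵥ (M *ᵥ v) = star v ⬝ᵥ v := by
  rw [Matrix.star_mulVec, ← Matrix.dotProduct_mulVec, Matrix.mulVec_mulVec, hM, Matrix.one_mulVec]

/-- From a unit vector `v` fixed by all `z i`, `φ y` is obtained by applying `x i` for each `i ∈ s`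
with `y i = 1`. The two clauses on `i ∉ s` are needed only for the induction. -/
theorem exists_vectors [Fintype α] [DecidableEq α] [Nonempty κ] (h : PauliRelations x z)
    (s : Finset α) :
    ∃ φ : QubitBasis α → κ → ℂ, (∀ y, star (φ y) ⬝ᵥ φ y = 1) ∧
      (∀ i ∈ s, ∀ y, x i *ᵥ φ y = φ (flipBit i y)) ∧
      (∀ i ∈ s, ∀ y, z i *ᵥ φ y = (-1 : ℂ) ^ (y i).val • φ y) ∧
      (∀ i ∉ s, ∀ y, z i *ᵥ φ y = φ y) ∧
      (∀ i ∉ s, ∀ y, φ (flipBit i y) = φ y) := by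
  induction s using Finset.induction_on with
  | empty =>
    obtain ⟨v, hv, hz⟩ := h.exists_unit_joint_eigenvector
    exact ⟨fun _ => v, fun _ => hv, by simp, by simp, fun i _ _ => hz i, by simp⟩
  | insert j s hj ih =>
    obtain ⟨φ, hn, hx, hz, hz', hf⟩ := ih
    have hflip : ∀ i y, i ≠ j → flipBit i y j = y j := fun i y hij => by
      simp [flipBit, hij.symm]
    have h01 : ∀ a : Fin 2, a ≠ 0 → a = 1 := by decide
    have hj1 : ∀ y : QubitBasis α, flipBit j y j = y j + 1 := fun y => by simp [flipBit]
    refine ⟨fun y => if y j = 0 then φ y else x j *ᵥ φ y, fun y => ?_, fun i hi y => ?_,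
      fun i hi y => ?_, fun i hi y => ?_, fun i hi y => ?_⟩
    · by_cases hy : y j = 0
      · simp only [hy, if_true, hn]
      · simp only [hy, if_false]
        rw [dotProduct_mulVec_self (by rw [h.x_conj, h.x_sq]), hn]
    · by_cases hij : i = j
      · subst hij
        simp only [hj1, hf i hj]
        by_cases hy : y i = 0
        · simp [hy]
        · simp [h01 _ hy, h.x_sq]
      · have his := Finset.mem_of_mem_insert_of_ne hi hij
        simp only [hflip i y hij]
        by_cases hy : y j = 0
        · simp only [hy, if_true, hx i his]
        · simp only [hy, if_false]
          rw [Matrix.mulVec_mulVec, h.x_comm, ← Matrix.mulVec_mulVec, hx i his]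
    · by_cases hij : i = j
      · subst hij
        by_cases hy : y i = 0
        · simp [hy, hz' i hj]
        · simp only [if_neg hy]
          rw [Matrix.mulVec_mulVec, h.xz_anti, Matrix.neg_mulVec,
            ← Matrix.mulVec_mulVec, hz' i hj, h01 _ hy]
          simp
      · have his := Finset.mem_of_mem_insert_of_ne hi hij
        by_cases hy : y j = 0
        · simp only [hy, if_true, hz i his]
        · simp only [hy, if_false]
          rw [Matrix.mulVec_mulVec, h.xz_comm i j hij, ← Matrix.mulVec_mulVec, hz i his,
            Matrix.mulVec_smul]
    · have hij : i ≠ j := fun e => hi (e ▸ Finset.mem_insert_self _ _)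
      have his : i ∉ s := fun e => hi (Finset.mem_insert_of_mem e)
      by_cases hy : y j = 0
      · simp only [hy, if_true, hz' i his]
      · simp only [hy, if_false]
        rw [Matrix.mulVec_mulVec, h.xz_comm i j hij, ← Matrix.mulVec_mulVec, hz' i his]
    · have hij : i ≠ j := fun e => hi (e ▸ Finset.mem_insert_self _ _)
      have his : i ∉ s := fun e => hi (Finset.mem_insert_of_mem e)
      simp only [hflip i y hij, hf i his]

/-- The Pauli relations determine the representation up to an isometry. -/
theorem exists_isometry [Fintype α] [DecidableEq α] [Nonempty κ] (h : PauliRelations x z) :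
    ∃ V : Matrix κ (QubitBasis α) ℂ, Vᴴ * V = 1 ∧
      (∀ i, x i * V = V * siteOp i Pauli.X.matrix) ∧
      (∀ i, z i * V = V * siteOp i Pauli.Z.matrix) := by
  obtain ⟨φ, hn, hx, hz, -, -⟩ := h.exists_vectors Finset.univ
  refine ⟨Matrix.of fun k y => φ y k, ?_, fun i => ?_, fun i => ?_⟩
  · ext y y'
    show star (φ y) ⬝ᵥ φ y' = _
    by_cases hy : y = y'
    · subst hy; simp [hn]
    · rw [Matrix.one_apply_ne hy]
      obtain ⟨i, hi⟩ := Function.ne_iff.mp hy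
      -- Eigenvectors of the Hermitian `z i` for the distinct eigenvalues 1 and -1 are orthogonal.
      have h1 : star (z i *ᵥ φ y) ⬝ᵥ φ y' = star (φ y) ⬝ᵥ (z i *ᵥ φ y') := by
        rw [Matrix.star_mulVec, h.z_conj, Matrix.dotProduct_mulVec]
      rw [hz i (Finset.mem_univ i), hz i (Finset.mem_univ i), star_smul, smul_dotProduct,
        dotProduct_smul] at h1
      have hne : ∀ a b : Fin 2, a ≠ b → ∀ c : ℂ,
          star ((-1 : ℂ) ^ a.val) • c = (-1 : ℂ) ^ b.val • c → c = 0 := by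
        intro a b hab c hc
        fin_cases a <;> fin_cases b <;> simp at hab hc ⊢
        · exact self_eq_neg.mp hc
        · exact self_eq_neg.mp hc.symm
      exact hne _ _ hi _ h1
  · ext k y
    rw [mul_siteOp_X_apply]
    exact congrFun (hx i (Finset.mem_univ i) y) k
  · ext k y
    rw [siteOp_Z_eq, Matrix.mul_diagonal, mul_comm]
    exact congrFun (hz i (Finset.mem_univ i) y) k

/-- This bounds the size of a family of Pauli pairs, so that a largest one exists. -/
theorem two_pow_card_le [Fintype α] [Nonempty κ] (h : PauliRelations x z) :
    2 ^ Fintype.card α ≤ Fintype.card κ := by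
  classical
  obtain ⟨V, hV, -, -⟩ := h.exists_isometry
  have h1 : (Vᴴ * V).rank ≤ V.rank := Matrix.rank_mul_le_right _ _
  rw [hV, Matrix.rank_one] at h1
  have h2 := V.rank_le_card_height
  simpa [QubitBasis] using h1.trans h2

end PauliRelations

/-! ### Irreducible monoids of unitaries that commute up to phases -/

theorem commute_mul_of_anticommute {R : Type*} [Ring R] {p m a : R} (hp : p * a = -(a * p))
    (hm : m * a = -(a * m)) : Commute (p * m) a := by
  rw [commute_iff_eq, mul_assoc, hm, mul_neg, ← mul_assoc, hp, neg_mul, neg_neg, mul_assoc]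

namespace PauliRelations

variable {α κ : Type} [Fintype κ] [DecidableEq κ] {x z : α → Matrix κ κ ℂ}

/-- The submonoid generated by a family satisfying the Pauli relations. -/
def generated (x z : α → Matrix κ κ ℂ) : Submonoid (Matrix κ κ ℂ) :=
  Submonoid.closure (Set.range x ∪ Set.range z)

theorem x_mem_generated (x z : α → Matrix κ κ ℂ) (i : α) : x i ∈ generated x z :=
  Submonoid.subset_closure (Or.inl ⟨i, rfl⟩)

theorem z_mem_generated (x z : α → Matrix κ κ ℂ) (i : α) : z i ∈ generated x z :=
  Submonoid.subset_closure (Or.inr ⟨i, rfl⟩)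

theorem commute_of_mem_generated {P : Matrix κ κ ℂ} (hx : ∀ i, Commute P (x i))
    (hz : ∀ i, Commute P (z i)) {m : Matrix κ κ ℂ} (hm : m ∈ generated x z) : Commute P m := by
  induction hm using Submonoid.closure_induction with
  | mem m hm =>
    rcases hm with ⟨i, rfl⟩ | ⟨i, rfl⟩
    exacts [hx i, hz i]
  | one => exact Commute.one_right _
  | mul a b _ _ ha hb => exact ha.mul_right hb

/-- One of 1, `x j`, `z j`, `x j * z j` has the same commutation signs with `x j` and `z j` as `m`;
multiplying by it cancels them without disturbing the other sites. -/
theorem exists_mul_commute_at (h : PauliRelations x z) (j : α) {m : Matrix κ κ ℂ}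
    (hx : m * x j = x j * m ∨ m * x j = -(x j * m))
    (hz : m * z j = z j * m ∨ m * z j = -(z j * m)) :
    ∃ p ∈ generated x z, (∀ i, i ≠ j → Commute p (x i) ∧ Commute p (z i)) ∧
      Commute (p * m) (x j) ∧ Commute (p * m) (z j) := by
  have hX : ∀ i, i ≠ j → Commute (x j) (x i) ∧ Commute (x j) (z i) := fun i hi =>
    ⟨h.x_comm j i, (h.xz_comm i j hi).symm⟩
  have hZ : ∀ i, i ≠ j → Commute (z j) (x i) ∧ Commute (z j) (z i) := fun i hi =>
    ⟨h.xz_comm j i hi.symm, h.z_comm j i⟩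
  have hxz : x j * z j = -(z j * x j) := by rw [h.xz_anti, neg_neg]
  rcases hx with hx | hx <;> rcases hz with hz | hz
  · exact ⟨1, one_mem _, fun i _ => ⟨Commute.one_left _, Commute.one_left _⟩,
      by rw [one_mul]; exact hx, by rw [one_mul]; exact hz⟩
  · exact ⟨x j, x_mem_generated x z j, hX, (Commute.refl _).mul_left hx,
      commute_mul_of_anticommute hxz hz⟩
  · exact ⟨z j, z_mem_generated x z j, hZ, commute_mul_of_anticommute (h.xz_anti j) hx,
      (Commute.refl _).mul_left hz⟩
  · refine ⟨x j * z j, mul_mem (x_mem_generated x z j) (z_mem_generated x z j),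
      fun i hi => ⟨(hX i hi).1.mul_left (hZ i hi).1, (hX i hi).2.mul_left (hZ i hi).2⟩, ?_, ?_⟩
    · refine commute_mul_of_anticommute ?_ hx
      rw [mul_assoc, h.xz_anti, mul_neg]
    · refine commute_mul_of_anticommute ?_ hz
      rw [← mul_assoc (z j), h.xz_anti, neg_mul, neg_neg]

theorem fin_cons {k : ℕ} {x z : Fin k → Matrix κ κ ℂ} (h : PauliRelations x z)
    {a b : Matrix κ κ ℂ} (ha : aᴴ = a) (hb : bᴴ = b) (ha2 : a * a = 1) (hb2 : b * b = 1)
    (hab : b * a = -(a * b)) (hax : ∀ i, Commute a (x i)) (haz : ∀ i, Commute a (z i))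
    (hbx : ∀ i, Commute b (x i)) (hbz : ∀ i, Commute b (z i)) :
    PauliRelations (Fin.cons a x : Fin (k + 1) → Matrix κ κ ℂ) (Fin.cons b z) where
  x_conj := Fin.cases ha h.x_conj
  z_conj := Fin.cases hb h.z_conj
  x_sq := Fin.cases ha2 h.x_sq
  z_sq := Fin.cases hb2 h.z_sq
  x_comm := Fin.cases (Fin.cases rfl hax) fun i => Fin.cases (hax i).symm (h.x_comm i)
  z_comm := Fin.cases (Fin.cases rfl hbz) fun i => Fin.cases (hbz i).symm (h.z_comm i)
  xz_comm := Fin.cases (Fin.cases (fun e => absurd rfl e) fun i _ => hbx i) fun i =>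
    Fin.cases (fun _ => (haz i).symm) fun j hij => h.xz_comm i j fun e => hij (e ▸ rfl)
  xz_anti := Fin.cases hab h.xz_anti

end PauliRelations

/-- An irreducible monoid of unitaries, closed under phases, whose elements square to scalars
and commute up to scalars. -/
structure IsPauliLike {κ : Type} [Fintype κ] [DecidableEq κ]
    (G : Submonoid (Matrix κ κ ℂ)) : Prop where
  unitary : ∀ g ∈ G, gᴴ * g = 1
  phase : ∀ c : ℂ, star c * c = 1 → ∀ g ∈ G, c • g ∈ G
  sq : ∀ g ∈ G, ∃ c : ℂ, g * g = c • 1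
  comm : ∀ g ∈ G, ∀ h ∈ G, ∃ c : ℂ, g * h = c • (h * g)
  commutant : ∀ M : Matrix κ κ ℂ, (∀ g ∈ G, Commute M g) → ∃ c : ℂ, M = c • 1

namespace IsPauliLike

set_option linter.unusedSectionVars false

variable {κ : Type} [Fintype κ] [DecidableEq κ] [Nonempty κ] {G : Submonoid (Matrix κ κ ℂ)}

theorem smul_one_injective {c d : ℂ} (h : c • (1 : Matrix κ κ ℂ) = d • 1) : c = d := by
  obtain ⟨k⟩ := ‹Nonempty κ›
  simpa using congrFun (congrFun h k) k

theorem sq_phase (hG : IsPauliLike G) {g : Matrix κ κ ℂ} (hg : g ∈ G) {c : ℂ}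
    (hc : g * g = c • 1) : star c * c = 1 := by
  have h := hG.unitary _ (mul_mem hg hg)
  rw [hc, Matrix.conjTranspose_smul, Matrix.conjTranspose_one, Matrix.smul_mul, Matrix.one_mul,
    smul_smul] at h
  exact smul_one_injective (h.trans (one_smul _ _).symm)

/-- Moving `g` past `h` twice multiplies by `c ^ 2`, while `g * g` is a nonzero scalar and commutes
with `h`. Hence `c ^ 2 = 1`. -/
theorem commute_or_anticommute (hG : IsPauliLike G) {g h : Matrix κ κ ℂ} (hg : g ∈ G)
    (hh : h ∈ G) : g * h = h * g ∨ g * h = -(h * g) := by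
  obtain ⟨c, hc⟩ := hG.comm g hg h hh
  obtain ⟨μ, hμ⟩ := hG.sq g hg
  have hμ0 : μ ≠ 0 := fun e => by simpa [e] using hG.sq_phase hg hμ
  have h1 : g * g * h = (c * c) • (h * (g * g)) := by
    rw [mul_assoc, hc, Matrix.mul_smul, ← mul_assoc g h g, hc, Matrix.smul_mul, smul_smul,
      mul_assoc]
  rw [hμ, Matrix.smul_mul, Matrix.one_mul, Matrix.mul_smul, Matrix.mul_one, smul_smul] at h1
  have h2 : μ • (1 : Matrix κ κ ℂ) = (c * c * μ) • 1 := by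
    have := congrArg (hᴴ * ·) h1
    simpa only [Matrix.mul_smul, hG.unitary h hh] using this
  have h3 : c * c = 1 := by
    have := smul_one_injective h2
    exact mul_right_cancel₀ hμ0 (by rw [one_mul]; exact this.symm)
  rcases mul_self_eq_one_iff.mp h3 with e | e
  · left; rw [hc, e, one_smul]
  · right; rw [hc, e, neg_one_smul]

/-- With `g * g = μ • 1` and `|μ| = 1`, a square root `c` of the conjugate of `μ` normalizes the
square to 1; a unitary involution is Hermitian. -/
theorem exists_involution (hG : IsPauliLike G) {g : Matrix κ κ ℂ} (hg : g ∈ G) :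
    ∃ c : ℂ, c ≠ 0 ∧ c • g ∈ G ∧ (c • g)ᴴ = c • g ∧ (c • g) * (c • g) = 1 := by
  obtain ⟨μ, hμ⟩ := hG.sq g hg
  have hμ1 := hG.sq_phase hg hμ
  obtain ⟨c, hc⟩ := IsAlgClosed.exists_pow_nat_eq (star μ) (n := 2) two_pos
  have hnorm : ‖c‖ = 1 := by
    have h1 : ‖μ‖ * ‖μ‖ = 1 := by
      have := congrArg norm hμ1
      simpa using this
    have h2 : ‖c‖ ^ 2 = ‖μ‖ := by rw [← norm_pow, hc]; simp
    have h3 : ‖μ‖ = 1 := by nlinarith [norm_nonneg μ]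
    nlinarith [norm_nonneg c]
  have hcc : star c * c = 1 := by
    rw [Complex.star_def, mul_comm, Complex.mul_conj, Complex.normSq_eq_norm_sq, hnorm]
    norm_num
  have hmem := hG.phase c hcc g hg
  have hsq : (c • g) * (c • g) = 1 := by
    rw [Matrix.smul_mul, Matrix.mul_smul, smul_smul, hμ, smul_smul, ← pow_two, hc, hμ1, one_smul]
  refine ⟨c, fun e => by simp [e] at hcc, hmem, ?_, hsq⟩
  rw [← Matrix.mul_one (c • g)ᴴ, ← hsq, ← Matrix.mul_assoc, hG.unitary _ hmem, Matrix.one_mul]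

section Family

variable {α : Type} {x z : α → Matrix κ κ ℂ}

theorem generated_le (hx : ∀ i, x i ∈ G) (hz : ∀ i, z i ∈ G) :
    PauliRelations.generated x z ≤ G := by
  refine Submonoid.closure_le.mpr ?_
  rintro _ (⟨i, rfl⟩ | ⟨i, rfl⟩)
  exacts [hx i, hz i]

/-- The sites are corrected one at a time; the correction at `j` commutes with the pairs at all
other sites. -/
theorem exists_mul_commute [Fintype α] (hG : IsPauliLike G) (h : PauliRelations x z)
    (hx : ∀ i, x i ∈ G) (hz : ∀ i, z i ∈ G) {g : Matrix κ κ ℂ} (hg : g ∈ G) :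
    ∃ p ∈ PauliRelations.generated x z, ∀ i, Commute (p * g) (x i) ∧ Commute (p * g) (z i) := by
  classical
  suffices H : ∀ s : Finset α, ∃ p ∈ PauliRelations.generated x z,
      ∀ i ∈ s, Commute (p * g) (x i) ∧ Commute (p * g) (z i) by
    simpa using H Finset.univ
  intro s
  induction s using Finset.induction_on with
  | empty => exact ⟨1, one_mem _, by simp⟩
  | insert j s hj ih =>
    obtain ⟨p, hp, hs⟩ := ih
    have hpg := mul_mem (generated_le hx hz hp) hg
    obtain ⟨q, hq, hqi, hqj⟩ := h.exists_mul_commute_at j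
      (hG.commute_or_anticommute hpg (hx j)) (hG.commute_or_anticommute hpg (hz j))
    refine ⟨q * p, mul_mem hq hp, fun i hi => ?_⟩
    rw [mul_assoc]
    by_cases hij : i = j
    · subst hij; exact hqj
    · have his := hs i (Finset.mem_of_mem_insert_of_ne hi hij)
      exact ⟨(hqi i hij).1.mul_left his.1, (hqi i hij).2.mul_left his.2⟩

/-- If the elements commuting with a family of Pauli relations commute with each other, the
family acts irreducibly. -/
theorem card_eq_of_commute [Fintype α] (hG : IsPauliLike G) (h : PauliRelations x z)
    (hx : ∀ i, x i ∈ G) (hz : ∀ i, z i ∈ G)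
    (hcomm : ∀ a ∈ G, ∀ b ∈ G, (∀ i, Commute a (x i) ∧ Commute a (z i)) →
      (∀ i, Commute b (x i) ∧ Commute b (z i)) → Commute a b) :
    2 ^ Fintype.card α = Fintype.card κ := by
  classical
  have hle := generated_le hx hz
  have hcancel : ∀ p ∈ G, ∀ m g : Matrix κ κ ℂ, Commute m p → Commute m (p * g) →
      Commute m g := by
    intro p hp m g h1 h2
    have e : p * (m * g) = p * (g * m) := by
      rw [← mul_assoc, ← h1.eq, mul_assoc, h2.eq, mul_assoc]
    show m * g = g * m
    have := congrArg (pᴴ * ·) e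
    simpa only [← mul_assoc pᴴ p, hG.unitary p hp, one_mul] using this
  obtain ⟨V, hV, hVx, hVz⟩ := h.exists_isometry
  have hPcomm : ∀ (a : Matrix κ κ ℂ) (S : QubitOp α), aᴴ = a → Sᴴ = S → a * V = V * S →
      Commute (V * Vᴴ) a := by
    intro a S ha hS hVa
    have h2 : Vᴴ * a = S * Vᴴ := by
      have := congrArg Matrix.conjTranspose hVa
      rwa [Matrix.conjTranspose_mul, Matrix.conjTranspose_mul, ha, hS] at this
    rw [commute_iff_eq, Matrix.mul_assoc, h2, ← Matrix.mul_assoc, ← hVa, Matrix.mul_assoc]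
  have hPx : ∀ i, Commute (V * Vᴴ) (x i) := fun i =>
    hPcomm _ _ (h.x_conj i) (by rw [siteOp_pauli, conjTranspose_pauliOp]) (hVx i)
  have hPz : ∀ i, Commute (V * Vᴴ) (z i) := fun i =>
    hPcomm _ _ (h.z_conj i) (by rw [siteOp_pauli, conjTranspose_pauliOp]) (hVz i)
  -- Corrected elements `p * g` commute with all of `G`, hence are scalars. As the projection `V *
  -- Vᴴ` commutes with the family, it commutes with `p` and `p * g`, and so with `g`.
  obtain ⟨c, hc⟩ := hG.commutant (V * Vᴴ) fun g hg => by
    obtain ⟨p, hp, hpg⟩ := hG.exists_mul_commute h hx hz hg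
    have hpgG := mul_mem (hle hp) hg
    obtain ⟨d, hd⟩ := hG.commutant (p * g) fun k hk => by
      obtain ⟨q, hq, hqk⟩ := hG.exists_mul_commute h hx hz hk
      refine hcancel q (hle hq) _ _ (PauliRelations.commute_of_mem_generated
        (fun i => (hpg i).1) (fun i => (hpg i).2) hq) ?_
      exact hcomm _ hpgG _ (mul_mem (hle hq) hk) hpg hqk
    refine hcancel p (hle hp) _ _ (PauliRelations.commute_of_mem_generated hPx hPz hp) ?_
    rw [hd]
    exact (Commute.one_right _).smul_right d
  have hcV : c • (1 : QubitOp α) = (1 : ℂ) • 1 := by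
    have h1 : Vᴴ * (V * Vᴴ) * V = 1 := by
      rw [← Matrix.mul_assoc, hV, Matrix.one_mul, hV]
    rwa [hc, Matrix.mul_smul, Matrix.mul_one, Matrix.smul_mul, hV, ← one_smul ℂ 1, smul_smul,
      mul_one] at h1
  have hc1 : c = 1 := smul_one_injective hcV
  have htr := Matrix.trace_mul_comm V Vᴴ
  rw [hV, hc, hc1, one_smul, Matrix.trace_one, Matrix.trace_one] at htr
  have h3 : Fintype.card κ = Fintype.card (QubitBasis α) := by exact_mod_cast htr
  simpa [QubitBasis] using h3.symm

end Family

theorem exists_pauliRelations (hG : IsPauliLike G) :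
    ∃ (k : ℕ) (x z : Fin k → Matrix κ κ ℂ), PauliRelations x z ∧ (∀ i, x i ∈ G) ∧
      (∀ i, z i ∈ G) ∧ 2 ^ k = Fintype.card κ := by
  classical
  let Q : ℕ → Prop := fun k => ∃ x z : Fin k → Matrix κ κ ℂ,
    PauliRelations x z ∧ (∀ i, x i ∈ G) ∧ (∀ i, z i ∈ G)
  have hQ0 : Q 0 := ⟨Fin.elim0, Fin.elim0, by constructor <;> exact fun i => i.elim0,
    fun i => i.elim0, fun i => i.elim0⟩
  have hbound : ∀ k, Q k → k ≤ Fintype.card κ := by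
    rintro k ⟨x, z, h, -, -⟩
    have := h.two_pow_card_le
    rw [Fintype.card_fin] at this
    exact k.lt_two_pow_self.le.trans this
  -- The search up to `card κ` misses nothing, since `k < 2 ^ k ≤ card κ` for every admissible `k`.
  have hk : Q (Nat.findGreatest Q (Fintype.card κ)) := Nat.findGreatest_spec (Nat.zero_le _) hQ0
  have hmax : ¬ Q (Nat.findGreatest Q (Fintype.card κ) + 1) := fun h =>
    absurd (Nat.le_findGreatest (hbound _ h) h) (by omega)
  set k := Nat.findGreatest Q (Fintype.card κ)
  obtain ⟨x, z, h, hx, hz⟩ := hk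
  refine ⟨k, x, z, h, hx, hz, ?_⟩
  rw [← Fintype.card_fin k]
  refine hG.card_eq_of_commute h hx hz fun a ha b hb hac hbc => ?_
  by_contra hab
  refine hmax ?_
  -- Noncommuting `a` and `b` anticommute; rescaled to Hermitian involutions, they extend the
  -- maximal family by one pair.
  have hba : b * a = -(a * b) :=
    (hG.commute_or_anticommute hb ha).resolve_left fun e => hab e.symm
  obtain ⟨c, hc0, hcG, hcH, hc2⟩ := hG.exists_involution ha
  obtain ⟨d, hd0, hdG, hdH, hd2⟩ := hG.exists_involution hb
  refine ⟨Fin.cons (c • a) x, Fin.cons (d • b) z, h.fin_cons hcH hdH hc2 hd2 ?_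
    (fun i => (hac i).1.smul_left c) (fun i => (hac i).2.smul_left c)
    (fun i => (hbc i).1.smul_left d) (fun i => (hbc i).2.smul_left d),
    Fin.cases hcG hx, Fin.cases hdG hz⟩
  simp only [Matrix.smul_mul, Matrix.mul_smul, hba, smul_neg, smul_smul, mul_comm c d]

/-- A Pauli-like monoid on qubits consists, in a suitable basis, of multiples of Pauli strings. -/
theorem exists_unitary {ι : Type} [Fintype ι] [DecidableEq ι] {G : Submonoid (QubitOp ι)}
    (hG : IsPauliLike G) :
    ∃ V : QubitUnitary ι, ∀ g ∈ G, ∃ (c : ℂ) (s : ι → Pauli),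
      (V : QubitOp ι)ᴴ * g * (V : QubitOp ι) = c • pauliOp s := by
  obtain ⟨k, x', z', h', hx', hz', hk⟩ := hG.exists_pauliRelations
  have hk' : k = Fintype.card ι := by
    have : Fintype.card (QubitBasis ι) = 2 ^ Fintype.card ι := by simp [QubitBasis]
    exact Nat.pow_right_injective le_rfl (hk.trans this)
  let e : ι ≃ Fin k := (Fintype.equivFin ι).trans (finCongr hk'.symm)
  have h : PauliRelations (x' ∘ e) (z' ∘ e) :=
    ⟨fun _ => h'.x_conj _, fun _ => h'.z_conj _, fun _ => h'.x_sq _, fun _ => h'.z_sq _,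
      fun _ _ => h'.x_comm _ _, fun _ _ => h'.z_comm _ _,
      fun _ _ hij => h'.xz_comm _ _ (e.injective.ne hij), fun _ => h'.xz_anti _⟩
  obtain ⟨V, hV, hVx, hVz⟩ := h.exists_isometry
  have hV' : V * Vᴴ = 1 := mul_eq_one_comm.mp hV
  refine ⟨⟨V, Matrix.mem_unitaryGroup_iff.mpr hV'⟩, fun g hg => ?_⟩
  -- Conjugation by the unitary `V` turns the signs of `g` against the family into signs against the
  -- single-site `X` and `Z`, which identify a Pauli string.
  have key : ∀ (a : QubitOp ι) (S : QubitOp ι), a ∈ G → a * V = V * S →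
      ∃ ε : ℂ, (ε = 1 ∨ ε = -1) ∧ Vᴴ * g * V * S = ε • (S * (Vᴴ * g * V)) := by
    intro a S ha haV
    have hS : S = Vᴴ * a * V := by
      rw [Matrix.mul_assoc, haV, ← Matrix.mul_assoc, hV, Matrix.one_mul]
    have h1 : ∀ A B : QubitOp ι, Vᴴ * A * V * (Vᴴ * B * V) = Vᴴ * (A * B) * V := by
      intro A B
      calc _ = Vᴴ * A * (V * Vᴴ) * B * V := by simp only [Matrix.mul_assoc]
        _ = _ := by rw [hV', Matrix.mul_one]; simp only [Matrix.mul_assoc]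
    rw [hS]
    rcases hG.commute_or_anticommute hg ha with hc | hc
    · exact ⟨1, Or.inl rfl, by rw [h1, h1, hc, one_smul]⟩
    · exact ⟨-1, Or.inr rfl, by rw [h1, h1, hc, neg_one_smul, Matrix.mul_neg, Matrix.neg_mul]⟩
  choose ε hε hεX using fun i => key _ _ (hx' (e i)) (hVx i)
  choose δ hδ hδZ using fun i => key _ _ (hz' (e i)) (hVz i)
  exact exists_eq_smul_pauliOp hε hδ hεX hδZ

end IsPauliLike

/-! ### Vanishing entropy -/

theorem EntropicMeasure.eval_one (S : EntropicMeasure) {p : Fin 1 → ℝ} (hp : p 0 = 1) :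
    S.eval p = 0 := by
  cases S with
  | renyi α => simp [EntropicMeasure.eval, renyiEntropy, hp]
  | linear => simp [EntropicMeasure.eval, hp]
  | concave f hf h0 h1 => simp [EntropicMeasure.eval, hp, h1]

/-- For weights strictly between 0 and 1, `p i ^ α` exceeds `p i` when `α < 1` (including `α = 0`)
and is below it when `α > 1`; the sign of `1 - α` compensates. -/
theorem renyiEntropy_pos (α : ℝ≥0∞) {r : ℕ} {p : Fin r → ℝ} (hr : 0 < r) (h0 : ∀ i, 0 < p i)
    (hlt : ∀ i, p i < 1) (hsum : ∑ i, p i = 1) : 0 < renyiEntropy α p := by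
  have : Nonempty (Fin r) := ⟨⟨0, hr⟩⟩
  unfold renyiEntropy
  split_ifs with h1 h2
  · rw [← Finset.sum_neg_distrib]
    refine Finset.sum_pos (fun i _ => ?_) Finset.univ_nonempty
    have := mul_neg_of_pos_of_neg (h0 i) (Real.log_neg (h0 i) (hlt i))
    linarith
  · obtain ⟨i, hi⟩ := exists_eq_ciSup_of_finite (f := p)
    rw [← hi]
    exact neg_pos.mpr (Real.log_neg (h0 i) (hlt i))
  · have hα : α.toReal ≠ 1 := fun e => h1 (by
      rw [← ENNReal.ofReal_toReal h2, e, ENNReal.ofReal_one])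
    rcases lt_or_gt_of_ne hα with h | h
    · have : 1 < ∑ i, p i ^ α.toReal := by
        rw [← hsum]
        refine Finset.sum_lt_sum_of_nonempty Finset.univ_nonempty fun i _ => ?_
        simpa using Real.rpow_lt_rpow_of_exponent_gt (h0 i) (hlt i) h
      exact mul_pos (one_div_pos.mpr (sub_pos.mpr h)) (Real.log_pos this)
    · have hs : ∑ i, p i ^ α.toReal < 1 := by
        rw [← hsum]
        refine Finset.sum_lt_sum_of_nonempty Finset.univ_nonempty fun i _ => ?_
        simpa using Real.rpow_lt_rpow_of_exponent_gt (h0 i) (hlt i) h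
      have hs0 : 0 < ∑ i, p i ^ α.toReal :=
        Finset.sum_pos (fun i _ => Real.rpow_pos_of_pos (h0 i) _) Finset.univ_nonempty
      exact mul_pos_of_neg_of_neg (one_div_neg.mpr (sub_neg.mpr h)) (Real.log_neg hs0 hs)

theorem StrictConcaveOn.pos_of_boundary {f : ℝ → ℝ} (hf : StrictConcaveOn ℝ (Set.Icc 0 1) f)
    (h0 : f 0 = 0) (h1 : f 1 = 0) {x : ℝ} (hx0 : 0 < x) (hx1 : x < 1) : 0 < f x := by
  have := hf.2 (Set.left_mem_Icc.mpr zero_le_one) (Set.right_mem_Icc.mpr zero_le_one)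
    zero_ne_one (sub_pos.mpr hx1) hx0 (sub_add_cancel _ _)
  simpa [h0, h1] using this

theorem EntropicMeasure.eval_pos (S : EntropicMeasure) {r : ℕ} {p : Fin r → ℝ} (hr : 0 < r)
    (h0 : ∀ i, 0 < p i) (hlt : ∀ i, p i < 1) (hsum : ∑ i, p i = 1) : 0 < S.eval p := by
  have : Nonempty (Fin r) := ⟨⟨0, hr⟩⟩
  cases S with
  | renyi α => exact renyiEntropy_pos α hr h0 hlt hsum
  | linear =>
    refine sub_pos.mpr ?_
    conv_rhs => rw [← hsum]
    exact Finset.sum_lt_sum_of_nonempty Finset.univ_nonempty fun i _ => by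
      nlinarith [h0 i, hlt i]
  | concave f hf hf0 hf1 =>
    exact Finset.sum_pos (fun i _ => hf.pos_of_boundary hf0 hf1 (h0 i) (hlt i))
      Finset.univ_nonempty

/-- Every entropic measure vanishes only on deterministic distributions. -/
theorem EntropicMeasure.eq_one_of_eval_eq_zero (S : EntropicMeasure) {r : ℕ} {p : Fin r → ℝ}
    (h0 : ∀ i, 0 < p i) (hsum : ∑ i, p i = 1) (h : S.eval p = 0) : r = 1 := by
  by_contra hr
  have hr0 : r ≠ 0 := by
    rintro rfl
    simp at hsum
  -- With at least two positive weights of total 1, each is less than 1.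
  refine (S.eval_pos (Nat.pos_of_ne_zero hr0) h0 (fun i => ?_) hsum).ne' h
  have : Nontrivial (Fin r) := Fin.nontrivial_iff_two_le.mpr (by omega)
  obtain ⟨j, hj⟩ := exists_ne i
  rw [← hsum]
  exact Finset.single_lt_sum hj (Finset.mem_univ i) (Finset.mem_univ j) (h0 j)
    fun k _ _ => (h0 k).le

/-! ### Product operators across a bipartition -/

section Bipartition

variable {N : ℕ} {A : Finset (Fin N)}

theorem localTensor_eq_submatrix (X : QubitOp {i // i ∈ A}) (Y : QubitOp {i // i ∉ A}) :
    localTensor A X Y = (X ⊗ₖ Y).submatrix (splitBasis A) (splitBasis A) := rfl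

theorem localTensor_mul (X X' : QubitOp {i // i ∈ A}) (Y Y' : QubitOp {i // i ∉ A}) :
    localTensor A X Y * localTensor A X' Y' = localTensor A (X * X') (Y * Y') := by
  rw [localTensor_eq_submatrix, localTensor_eq_submatrix, Matrix.submatrix_mul_equiv,
    ← Matrix.mul_kronecker_mul, ← localTensor_eq_submatrix]

theorem localTensor_one : localTensor A 1 1 = 1 := by
  rw [localTensor_eq_submatrix, Matrix.one_kronecker_one, Matrix.submatrix_one_equiv]

theorem localTensor_smul_smul (c d : ℂ) (X : QubitOp {i // i ∈ A}) (Y : QubitOp {i // i ∉ A}) :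
    localTensor A (c • X) (d • Y) = (c * d) • localTensor A X Y := by
  ext x y
  simp only [localTensor, Matrix.of_apply, Matrix.smul_apply, smul_eq_mul]
  ring

theorem conjTranspose_localTensor (X : QubitOp {i // i ∈ A}) (Y : QubitOp {i // i ∉ A}) :
    (localTensor A X Y)ᴴ = localTensor A Xᴴ Yᴴ := by
  ext x y
  simp [localTensor]

/-- Freezing the `B` indices at a nonzero entry of `Y` leaves a proportionality on `A`. -/
theorem localTensor_left_cancel {X X' : QubitOp {i // i ∈ A}} {Y Y' : QubitOp {i // i ∉ A}}
    (hY : Y ≠ 0) (h : localTensor A X Y = localTensor A X' Y') : ∃ c : ℂ, X = c • X' := by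
  obtain ⟨b, b', hb⟩ : ∃ b b', Y b b' ≠ 0 := by
    by_contra! H
    exact hY (Matrix.ext H)
  refine ⟨Y' b b' / Y b b', ?_⟩
  ext a a'
  have := congrFun (congrFun h ((splitBasis A).symm (a, b))) ((splitBasis A).symm (a', b'))
  rw [localTensor_splitBasis_symm, localTensor_splitBasis_symm] at this
  rw [Matrix.smul_apply, smul_eq_mul, div_mul_eq_mul_div, eq_div_iff hb, this, mul_comm]

theorem localTensor_right_cancel {X X' : QubitOp {i // i ∈ A}} {Y Y' : QubitOp {i // i ∉ A}}
    (hX : X ≠ 0) (h : localTensor A X Y = localTensor A X' Y') : ∃ c : ℂ, Y = c • Y' := by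
  obtain ⟨a, a', ha⟩ : ∃ a a', X a a' ≠ 0 := by
    by_contra! H
    exact hX (Matrix.ext H)
  refine ⟨X' a a' / X a a', ?_⟩
  ext b b'
  have := congrFun (congrFun h ((splitBasis A).symm (a, b))) ((splitBasis A).symm (a', b'))
  rw [localTensor_splitBasis_symm, localTensor_splitBasis_symm] at this
  rw [Matrix.smul_apply, smul_eq_mul, div_mul_eq_mul_div, eq_div_iff ha, mul_comm, this]

theorem Matrix.ofReal_of_conjTranspose_mul_eq_smul {κ : Type} [Fintype κ] [DecidableEq κ]
    [Nonempty κ] {X : Matrix κ κ ℂ} {c : ℂ} (h : Xᴴ * X = c • 1) :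
    ∃ r : ℝ, 0 ≤ r ∧ c = r := by
  obtain ⟨k⟩ := ‹Nonempty κ›
  have h1 := congrFun (congrFun h k) k
  refine ⟨∑ j, Complex.normSq (X j k), Finset.sum_nonneg fun j _ => Complex.normSq_nonneg _, ?_⟩
  simp only [Matrix.mul_apply, Matrix.conjTranspose_apply, Matrix.smul_apply, Matrix.one_apply_eq,
    smul_eq_mul, mul_one] at h1
  rw [← h1]
  push_cast
  exact Finset.sum_congr rfl fun j _ => by rw [Complex.normSq_eq_conj_mul_self]; rfl

/-- The factors of a unitary product operator can be chosen unitary. -/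
theorem exists_unitary_factors {X : QubitOp {i // i ∈ A}} {Y : QubitOp {i // i ∉ A}}
    (h : (localTensor A X Y)ᴴ * localTensor A X Y = 1) :
    ∃ (X' : QubitOp {i // i ∈ A}) (Y' : QubitOp {i // i ∉ A}), X'ᴴ * X' = 1 ∧ Y'ᴴ * Y' = 1 ∧
      localTensor A X Y = localTensor A X' Y' := by
  rw [conjTranspose_localTensor, localTensor_mul, ← localTensor_one] at h
  have hz : ∀ (X : QubitOp {i // i ∈ A}) (Y : QubitOp {i // i ∉ A}),
      localTensor A X Y = localTensor A 1 1 → X ≠ 0 ∧ Y ≠ 0 := by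
    intro X Y hXY
    constructor
    · rintro rfl
      have := localTensor_smul_smul (A := A) 0 1 0 Y
      rw [zero_smul, one_smul, zero_mul, zero_smul, hXY, localTensor_one] at this
      exact one_ne_zero this
    · rintro rfl
      have := localTensor_smul_smul (A := A) 1 0 X 0
      rw [zero_smul, one_smul, mul_zero, zero_smul, hXY, localTensor_one] at this
      exact one_ne_zero this
  obtain ⟨c, hc⟩ := localTensor_left_cancel (hz _ _ h).2 h
  obtain ⟨d, hd⟩ := localTensor_right_cancel (hz _ _ h).1 h
  have hcd : c * d = 1 := by
    rw [hc, hd, localTensor_smul_smul, localTensor_one] at h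
    exact IsPauliLike.smul_one_injective (h.trans (one_smul _ _).symm)
  obtain ⟨r, hr, rfl⟩ := Matrix.ofReal_of_conjTranspose_mul_eq_smul hc
  obtain ⟨t, ht, rfl⟩ := Matrix.ofReal_of_conjTranspose_mul_eq_smul hd
  have hrt : r * t = 1 := by exact_mod_cast hcd
  have hsq : ∀ {κ : Type} [Fintype κ] [DecidableEq κ] (M : Matrix κ κ ℂ) (a b : ℝ), 0 ≤ b →
      a * b = 1 → Mᴴ * M = (a : ℂ) • 1 → (((√b : ℝ) : ℂ) • M)ᴴ * (((√b : ℝ) : ℂ) • M) = 1 := by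
    intro κ _ _ M a b hb hab hM
    rw [Matrix.conjTranspose_smul, Matrix.smul_mul, Matrix.mul_smul, hM, smul_smul, smul_smul,
      Complex.star_def, Complex.conj_ofReal, ← Complex.ofReal_mul, ← Complex.ofReal_mul,
      Real.mul_self_sqrt hb, mul_comm b, hab, Complex.ofReal_one, one_smul]
  -- Here `Xᴴ * X = r`, `Yᴴ * Y = t` and `r * t = 1`, so these factors normalize both operators
  -- while `√t * √r = 1` leaves the product unchanged.
  refine ⟨((√t : ℝ) : ℂ) • X, ((√r : ℝ) : ℂ) • Y, hsq X r t ht hrt hc,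
    hsq Y t r hr (by rwa [mul_comm]) hd, ?_⟩
  rw [localTensor_smul_smul, ← Complex.ofReal_mul, ← Real.sqrt_mul ht, mul_comm t, hrt,
    Real.sqrt_one, Complex.ofReal_one, one_smul]

theorem exists_localTensor_of_operatorEntanglement_eq_zero {S : EntropicMeasure}
    {O : QubitOp (Fin N)} (hO : Oᴴ * O = 1) (h : operatorEntanglement S A O = 0) :
    ∃ (X : QubitOp {i // i ∈ A}) (Y : QubitOp {i // i ∉ A}), Xᴴ * X = 1 ∧ Yᴴ * Y = 1 ∧
      O = localTensor A X Y := by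
  obtain ⟨r, c, L, R, hc, hL, hR, hexp⟩ := Classical.choice
    (OperatorSchmidt.exists_decomposition A O)
  let D : OperatorSchmidt A O := ⟨r, c, L, R, hc, hL, hR, hexp⟩
  have hr : r = 1 := S.eq_one_of_eval_eq_zero hc
    (D.sum_coeff (Matrix.mem_unitaryGroup_iff'.mpr hO)) ((operatorEntanglement_eq S D).symm.trans h)
  subst hr
  have hs : ((√(2 ^ N : ℝ) : ℝ) : ℂ) * (((√(2 ^ N : ℝ))⁻¹ : ℝ) : ℂ) = 1 := by
    rw [← Complex.ofReal_mul, mul_inv_cancel₀ (Real.sqrt_pos.mpr (by positivity)).ne',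
      Complex.ofReal_one]
  have hprod : O = localTensor A ((((√(2 ^ N : ℝ) : ℝ) : ℂ) * ((√(c 0) : ℝ) : ℂ)) • L 0)
      ((1 : ℂ) • R 0) := by
    rw [localTensor_smul_smul, mul_one, ← smul_smul]
    rw [Fin.sum_univ_one] at hexp
    rw [← hexp, smul_smul, hs, one_smul]
  rw [hprod] at hO ⊢
  exact exists_unitary_factors hO

/-- Dividing `X` and `Y` by the square roots of the dimensions of their spaces gives a Schmidt
decomposition with one term, because `d = d_A d_B`. -/
theorem operatorEntanglement_localTensor_eq_zero (S : EntropicMeasure)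
    {X : QubitOp {i // i ∈ A}} {Y : QubitOp {i // i ∉ A}} (hX : Xᴴ * X = 1) (hY : Yᴴ * Y = 1) :
    operatorEntanglement S A (localTensor A X Y) = 0 := by
  have hnorm : ∀ {κ : Type} [Fintype κ] [DecidableEq κ] [Nonempty κ] (M : Matrix κ κ ℂ),
      Mᴴ * M = 1 → (((((√(Fintype.card κ : ℝ))⁻¹ : ℝ) : ℂ) • M)ᴴ *
        ((((√(Fintype.card κ : ℝ))⁻¹ : ℝ) : ℂ) • M)).trace = 1 := by
    intro κ _ _ _ M hM
    have hpos : (0 : ℝ) < Fintype.card κ := by exact_mod_cast Fintype.card_pos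
    rw [Matrix.conjTranspose_smul, Matrix.smul_mul, Matrix.mul_smul, hM, smul_smul,
      Complex.star_def, Complex.conj_ofReal, ← Complex.ofReal_mul, ← mul_inv,
      Real.mul_self_sqrt hpos.le, Matrix.trace_smul, Matrix.trace_one, smul_eq_mul]
    push_cast
    exact inv_mul_cancel₀ (by exact_mod_cast hpos.ne')
  have hcard : (2 ^ N : ℝ) = (Fintype.card (QubitBasis {i // i ∈ A}) : ℝ) *
      (Fintype.card (QubitBasis {i // i ∉ A}) : ℝ) := by
    have h := Fintype.card_congr (splitBasis A)
    rw [Fintype.card_prod] at h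
    have h2 : Fintype.card (QubitBasis (Fin N)) = 2 ^ N := by simp [QubitBasis]
    rw [h2] at h
    exact_mod_cast h
  let D : OperatorSchmidt A (localTensor A X Y) :=
    { rank := 1
      coeff := fun _ => 1
      left := fun _ => (((√(Fintype.card (QubitBasis {i // i ∈ A}) : ℝ))⁻¹ : ℝ) : ℂ) • X
      right := fun _ => (((√(Fintype.card (QubitBasis {i // i ∉ A}) : ℝ))⁻¹ : ℝ) : ℂ) • Y
      coeff_pos := fun _ => one_pos
      left_orthonormal := fun i j => by rw [if_pos (Subsingleton.elim i j)]; exact hnorm X hX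
      right_orthonormal := fun i j => by rw [if_pos (Subsingleton.elim i j)]; exact hnorm Y hY
      expansion := by
        rw [Fin.sum_univ_one, localTensor_smul_smul, Real.sqrt_one, Complex.ofReal_one, one_smul,
          hcard, Real.sqrt_mul (Nat.cast_nonneg _), mul_inv, Complex.ofReal_mul] }
  rw [operatorEntanglement_eq S D]
  exact S.eval_one rfl

theorem localTensor_pauliOp (s : {i // i ∈ A} → Pauli) (t : {i // i ∉ A} → Pauli) :
    localTensor A (pauliOp s) (pauliOp t) =
      pauliString fun i => if h : i ∈ A then s ⟨i, h⟩ else t ⟨i, h⟩ := by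
  ext x y
  simp only [localTensor, pauliOp, tensorOp, pauliString, Matrix.of_apply]
  rw [← Fintype.prod_subtype_mul_prod_subtype (fun i => i ∈ A)]
  congr 1
  · exact Finset.prod_congr (Finset.ext fun _ => by simp) fun i _ => by rw [dif_pos i.2]
  · exact Finset.prod_congr (Finset.ext fun _ => by simp) fun i _ => by rw [dif_neg i.2]

theorem pauliString_eq_localTensor (s : Fin N → Pauli) :
    pauliString s = localTensor A (pauliOp fun i => s i.1) (pauliOp fun i => s i.1) := by
  rw [localTensor_pauliOp]
  simp

end Bipartition

/-! ### Local Pauli frames -/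

theorem pauliString_mul_self {N : ℕ} (s : Fin N → Pauli) : pauliString s * pauliString s = 1 :=
  pauliOp_mul_self s

/-- Taking the adjoint of a product of two Hermitian strings reverses the order and only conjugates
the phase. -/
theorem pauliString_mul_comm {N : ℕ} (s t : Fin N → Pauli) :
    ∃ c : ℂ, pauliString s * pauliString t = c • (pauliString t * pauliString s) := by
  obtain ⟨k, r, h⟩ := exists_pauliString_mul s t
  have h' := congrArg Matrix.conjTranspose h
  rw [Matrix.conjTranspose_mul, Matrix.conjTranspose_smul, conjTranspose_pauliString,
    conjTranspose_pauliString, conjTranspose_pauliString] at h'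
  have hk : star (Complex.I ^ k) ≠ 0 := star_ne_zero.mpr (pow_ne_zero _ Complex.I_ne_zero)
  exact ⟨Complex.I ^ k * (star (Complex.I ^ k))⁻¹, by
    rw [h, h', smul_smul, mul_assoc, inv_mul_cancel₀ hk, mul_one]⟩

/-- A matrix is a Pauli string up to a phase in `{1, i, -1, -i}`. -/
def IsPhasedPauli {N : ℕ} (M : QubitOp (Fin N)) : Prop :=
  ∃ (k : ℕ) (s : Fin N → Pauli), M = Complex.I ^ k • pauliString s

theorem IsPhasedPauli.mul {N : ℕ} {M M' : QubitOp (Fin N)} (h : IsPhasedPauli M)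
    (h' : IsPhasedPauli M') : IsPhasedPauli (M * M') := by
  obtain ⟨k, s, rfl⟩ := h
  obtain ⟨k', s', rfl⟩ := h'
  obtain ⟨l, r, hr⟩ := exists_pauliString_mul s s'
  exact ⟨k + k' + l, r, by
    rw [Matrix.smul_mul, Matrix.mul_smul, hr, smul_smul, smul_smul, pow_add, pow_add, mul_assoc]⟩

theorem Matrix.ne_zero_of_conjTranspose_mul_self {κ : Type} [Fintype κ] [DecidableEq κ]
    [Nonempty κ] {M : Matrix κ κ ℂ} (h : Mᴴ * M = 1) : M ≠ 0 := by
  rintro rfl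
  exact zero_ne_one (α := Matrix κ κ ℂ) (by simp at h)

theorem Matrix.conjTranspose_mul_self_mul {κ : Type} [Fintype κ] [DecidableEq κ]
    {M M' : Matrix κ κ ℂ} (h : Mᴴ * M = 1) (h' : M'ᴴ * M' = 1) : (M * M')ᴴ * (M * M') = 1 := by
  rw [Matrix.conjTranspose_mul, Matrix.mul_assoc, ← Matrix.mul_assoc Mᴴ, h, Matrix.one_mul, h']

/-- If every Pauli string is a product for a tensor product decomposition `T`, then the first
factors of the phased Pauli strings are, in a suitable basis, multiples of Pauli strings. -/
theorem exists_local_pauli_frame {N : ℕ} {ι κ : Type} [Fintype ι] [DecidableEq ι] [Fintype κ]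
    [DecidableEq κ] [Nonempty κ] (T : QubitOp ι → Matrix κ κ ℂ → QubitOp (Fin N))
    (hmul : ∀ a a' b b', T a b * T a' b' = T (a * a') (b * b')) (hone : T 1 1 = 1)
    (hsmul : ∀ (c d : ℂ) a b, T (c • a) (d • b) = (c * d) • T a b)
    (hcancel : ∀ a a' b b', b ≠ 0 → T a b = T a' b' → ∃ c : ℂ, a = c • a')
    (hprod : ∀ s : Fin N → Pauli, ∃ a b, aᴴ * a = 1 ∧ bᴴ * b = 1 ∧ pauliString s = T a b) :
    ∃ V : QubitUnitary ι, ∀ a b, aᴴ * a = 1 → bᴴ * b = 1 → IsPhasedPauli (T a b) →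
      ∃ (c : ℂ) (s : ι → Pauli), (V : QubitOp ι)ᴴ * a * (V : QubitOp ι) = c • pauliOp s := by
  have hsmul_left : ∀ (c : ℂ) a b, T (c • a) b = c • T a b := fun c a b => by
    rw [← one_smul ℂ b, hsmul, one_smul, mul_one]
  -- `T` is kept abstract so that the same argument serves `A` and, with the factors exchanged, `B`.
  let G : Submonoid (QubitOp ι) :=
    { carrier := {a | aᴴ * a = 1 ∧ ∃ b, bᴴ * b = 1 ∧ IsPhasedPauli (T a b)}
      one_mem' := ⟨by simp, 1, by simp, 0, fun _ => Pauli.I, by simp [hone, pauliString_one]⟩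
      mul_mem' := by
        rintro a a' ⟨ha, b, hb, hP⟩ ⟨ha', b', hb', hP'⟩
        exact ⟨Matrix.conjTranspose_mul_self_mul ha ha', b * b',
          Matrix.conjTranspose_mul_self_mul hb hb', hmul a a' b b' ▸ hP.mul hP'⟩ }
  have hG : IsPauliLike G :=
    { unitary := fun g hg => hg.1
      phase := by
        rintro c hc a ⟨ha, b, hb, hP⟩
        -- A phase on `a` is compensated by the conjugate phase on `b`.
        have hc' : c * star c = 1 := by rwa [mul_comm]
        refine ⟨?_, star c • b, ?_, ?_⟩
        · rw [Matrix.conjTranspose_smul, Matrix.smul_mul, Matrix.mul_smul, ha, smul_smul, hc,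
            one_smul]
        · rw [Matrix.conjTranspose_smul, Matrix.smul_mul, Matrix.mul_smul, hb, smul_smul,
            star_star, hc', one_smul]
        · rwa [hsmul, hc', one_smul]
      sq := by
        rintro a ⟨-, b, hb, k, s, hP⟩
        have h := hmul a a b b
        rw [hP, Matrix.smul_mul, Matrix.mul_smul, pauliString_mul_self, smul_smul, ← hone,
          ← hsmul_left] at h
        obtain ⟨c, hc⟩ := hcancel _ _ _ _ (Matrix.ne_zero_of_conjTranspose_mul_self
          (Matrix.conjTranspose_mul_self_mul hb hb)) h.symm
        exact ⟨_, hc.trans (smul_smul _ _ _)⟩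
      comm := by
        rintro a ⟨-, b, hb, k, s, hP⟩ a' ⟨-, b', hb', k', s', hP'⟩
        obtain ⟨c, hc⟩ := pauliString_mul_comm s s'
        have h : T (a * a') (b * b') = T (c • (a' * a)) (b' * b) := by
          rw [hsmul_left, ← hmul, ← hmul, hP, hP']
          simp only [Matrix.smul_mul, Matrix.mul_smul, hc, smul_smul]
          congr 1
          ring
        obtain ⟨d, hd⟩ := hcancel _ _ _ _ (Matrix.ne_zero_of_conjTranspose_mul_self
          (Matrix.conjTranspose_mul_self_mul hb hb')) h
        exact ⟨_, hd.trans (smul_smul _ _ _)⟩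
      commutant := by
        intro M hM
        have hcomm : ∀ s : Fin N → Pauli, T M 1 * pauliString s = pauliString s * T M 1 := by
          intro s
          obtain ⟨a, b, ha, hb, hab⟩ := hprod s
          have haG : a ∈ G := ⟨ha, b, hb, 0, s, by rw [pow_zero, one_smul, hab]⟩
          rw [hab, hmul, hmul, (hM a haG).eq, Matrix.one_mul, Matrix.mul_one]
        obtain ⟨c, hc⟩ := eq_smul_one_of_commute_siteOp (M := T M 1)
          (fun i => by rw [siteOp_pauli]; exact hcomm _)
          (fun i => by rw [siteOp_pauli]; exact hcomm _)
        rw [← hone, ← hsmul_left] at hc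
        obtain ⟨d, hd⟩ := hcancel _ _ _ _ one_ne_zero hc
        exact ⟨_, hd.trans (smul_smul _ _ _)⟩ }
  obtain ⟨V, hV⟩ := hG.exists_unitary
  exact ⟨V, fun a b ha hb hP => hV a ⟨ha, b, hb, hP⟩⟩

/-! ### Clifford unitaries -/

theorem Pauli.finite : Finite Pauli :=
  Finite.of_surjective (fun i : Fin 4 => ![Pauli.I, Pauli.X, Pauli.Y, Pauli.Z] i) (by
    rintro (_ | _ | _ | _)
    exacts [⟨0, rfl⟩, ⟨1, rfl⟩, ⟨2, rfl⟩, ⟨3, rfl⟩])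

theorem finite_pauliGroup (N : ℕ) :
    Finite (pauliGroup N : Set (QubitUnitary (Fin N))) := by
  have := Pauli.finite
  refine Set.Finite.to_subtype (Set.Finite.of_finite_image (f := Subtype.val) ?_
    Subtype.val_injective.injOn)
  refine (Set.finite_range fun q : Fin 4 × (Fin N → Pauli) =>
    Complex.I ^ q.1.val • pauliString q.2).subset ?_
  rintro _ ⟨M, ⟨k, s, h⟩, rfl⟩
  refine ⟨(⟨k % 4, Nat.mod_lt _ (by norm_num)⟩, s), ?_⟩
  have h4 : Complex.I ^ (k % 4) = Complex.I ^ k := by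
    conv_rhs => rw [← Nat.div_add_mod k 4, pow_add, pow_mul, Complex.I_pow_four, one_pow, one_mul]
  simp only [h4, h]

/-- A unitary that conjugates every Pauli string to a multiple of a Pauli string is Clifford. -/
theorem mem_cliffordGroup_of_forall {N : ℕ} (C : QubitUnitary (Fin N))
    (h : ∀ s, ∃ (c : ℂ) (t : Fin N → Pauli),
      (C : QubitOp (Fin N)) * pauliString s * (C : QubitOp (Fin N))ᴴ = c • pauliString t) :
    C ∈ cliffordGroup N := by
  have := finite_pauliGroup N
  -- The Pauli group is finite, so mapping it into itself by conjugation is enough.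
  refine Subgroup.mem_normalizer_fintype ?_
  rintro P ⟨k, s, hP⟩
  obtain ⟨c, t, hc⟩ := h s
  have hC : (C : QubitOp (Fin N))ᴴ * (C : QubitOp (Fin N)) = 1 := Unitary.coe_star_mul_self C
  have hC' : (C : QubitOp (Fin N)) * (C : QubitOp (Fin N))ᴴ = 1 := Unitary.coe_mul_star_self C
  -- The conjugate of a Pauli string is again an involution, which forces `c = ±1`, a power of `i`.
  have hc2 : c * c = 1 := by
    have h1 : (C : QubitOp (Fin N)) * pauliString s * (C : QubitOp (Fin N))ᴴ *
        ((C : QubitOp (Fin N)) * pauliString s * (C : QubitOp (Fin N))ᴴ) = 1 := by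
      calc _ = (C : QubitOp (Fin N)) * pauliString s *
            ((C : QubitOp (Fin N))ᴴ * (C : QubitOp (Fin N))) * pauliString s *
            (C : QubitOp (Fin N))ᴴ := by simp only [Matrix.mul_assoc]
        _ = (C : QubitOp (Fin N)) * (pauliString s * pauliString s) *
            (C : QubitOp (Fin N))ᴴ := by
          rw [hC, Matrix.mul_one]; simp only [Matrix.mul_assoc]
        _ = 1 := by rw [pauliString_mul_self, Matrix.mul_one, hC']
    rw [hc, Matrix.smul_mul, Matrix.mul_smul, pauliString_mul_self, smul_smul] at h1
    exact IsPauliLike.smul_one_injective (h1.trans (one_smul _ _).symm)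
  have hck : ∃ l : ℕ, c = Complex.I ^ l := by
    rcases mul_self_eq_one_iff.mp hc2 with e | e
    · exact ⟨0, by rw [e, pow_zero]⟩
    · exact ⟨2, by rw [e, Complex.I_sq]⟩
  obtain ⟨l, hl⟩ := hck
  refine ⟨k + l, t, ?_⟩
  show (C : QubitOp (Fin N)) * (P : QubitOp (Fin N)) * (C : QubitOp (Fin N))ᴴ = _
  rw [hP, Matrix.mul_smul, Matrix.smul_mul, hc, smul_smul, hl, pow_add]

theorem exists_conj_pauliString_of_mem_cliffordGroup {N : ℕ} {C : QubitUnitary (Fin N)}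
    (hC : C ∈ cliffordGroup N) (s : Fin N → Pauli) :
    IsPhasedPauli ((C : QubitOp (Fin N)) * pauliString s * (C : QubitOp (Fin N))ᴴ) := by
  have hs : pauliString s ∈ Matrix.unitaryGroup (QubitBasis (Fin N)) ℂ :=
    Matrix.mem_unitaryGroup_iff.mpr (by
      rw [Matrix.star_eq_conjTranspose, conjTranspose_pauliString, pauliString_mul_self])
  exact (Subgroup.mem_normalizer_iff.mp hC ⟨pauliString s, hs⟩).mp ⟨0, s, by simp⟩

/-! ### Unentangled Heisenberg-evolved Pauli strings -/

theorem operatorEntanglement_eq_zero_of_clifford {N : ℕ} {A : Finset (Fin N)}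
    {U C : QubitUnitary (Fin N)} {V : QubitUnitary {i // i ∈ A}} {W : QubitUnitary {i // i ∉ A}}
    (hC : C ∈ cliffordGroup N)
    (hU : (U : QubitOp (Fin N))ᴴ = localTensor A (V : QubitOp {i // i ∈ A})
      (W : QubitOp {i // i ∉ A}) * (C : QubitOp (Fin N)))
    (S : EntropicMeasure) (s : Fin N → Pauli) :
    operatorEntanglement S A
      ((U : QubitOp (Fin N))ᴴ * pauliString s * (U : QubitOp (Fin N))) = 0 := by
  obtain ⟨k, t, ht⟩ := exists_conj_pauliString_of_mem_cliffordGroup hC s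
  have hU' : (U : QubitOp (Fin N)) = (C : QubitOp (Fin N))ᴴ *
      localTensor A (V : QubitOp {i // i ∈ A})ᴴ (W : QubitOp {i // i ∉ A})ᴴ := by
    rw [← conjTranspose_localTensor, ← Matrix.conjTranspose_mul, ← hU,
      Matrix.conjTranspose_conjTranspose]
  have hk : star (Complex.I ^ k) * Complex.I ^ k = 1 := by
    rw [star_pow, ← mul_pow]
    simp
  have hX : ∀ {κ : Type} [Fintype κ] [DecidableEq κ] (V : QubitUnitary κ) (r : κ → Pauli),
      ((V : QubitOp κ) * pauliOp r * (V : QubitOp κ)ᴴ)ᴴ *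
        ((V : QubitOp κ) * pauliOp r * (V : QubitOp κ)ᴴ) = 1 := by
    intro κ _ _ V r
    have hV : (V : QubitOp κ)ᴴ * (V : QubitOp κ) = 1 := Unitary.coe_star_mul_self V
    have hV' : ((V : QubitOp κ)ᴴ)ᴴ * (V : QubitOp κ)ᴴ = 1 := by
      rw [Matrix.conjTranspose_conjTranspose]
      exact Unitary.coe_mul_star_self V
    exact Matrix.conjTranspose_mul_self_mul (Matrix.conjTranspose_mul_self_mul hV
      (by rw [conjTranspose_pauliOp, pauliOp_mul_self])) hV'
  -- The phase from the Clifford conjugation is absorbed in the factor on `A`.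
  have key : (U : QubitOp (Fin N))ᴴ * pauliString s * (U : QubitOp (Fin N)) =
      localTensor A
        (Complex.I ^ k • ((V : QubitOp {i // i ∈ A}) * pauliOp (fun i => t i.1) *
          (V : QubitOp {i // i ∈ A})ᴴ))
        ((1 : ℂ) • ((W : QubitOp {i // i ∉ A}) * pauliOp (fun i => t i.1) *
          (W : QubitOp {i // i ∉ A})ᴴ)) := by
    rw [localTensor_smul_smul, mul_one, ← localTensor_mul, ← localTensor_mul,
      ← pauliString_eq_localTensor, hU, hU']
    calc _ = localTensor A (V : QubitOp {i // i ∈ A}) (W : QubitOp {i // i ∉ A}) *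
          ((C : QubitOp (Fin N)) * pauliString s * (C : QubitOp (Fin N))ᴴ) *
          localTensor A (V : QubitOp {i // i ∈ A})ᴴ (W : QubitOp {i // i ∉ A})ᴴ := by
            simp only [Matrix.mul_assoc]
      _ = _ := by rw [ht, Matrix.mul_smul, Matrix.smul_mul]
  rw [key]
  refine operatorEntanglement_localTensor_eq_zero S ?_ ?_
  · rw [Matrix.conjTranspose_smul, Matrix.smul_mul, Matrix.mul_smul, hX, smul_smul, hk, one_smul]
  · rw [one_smul, hX]

theorem exists_clifford_of_operatorEntanglement_eq_zero {N : ℕ} {A : Finset (Fin N)}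
    {U : QubitUnitary (Fin N)} {S : EntropicMeasure}
    (h : ∀ s : Fin N → Pauli, operatorEntanglement S A
      ((U : QubitOp (Fin N))ᴴ * pauliString s * (U : QubitOp (Fin N))) = 0) :
    ∃ (V : QubitUnitary {i // i ∈ A}) (W : QubitUnitary {i // i ∉ A}) (C : QubitUnitary (Fin N)),
      C ∈ cliffordGroup N ∧
      (U : QubitOp (Fin N))ᴴ =
        localTensor A (V : QubitOp {i // i ∈ A}) (W : QubitOp {i // i ∉ A}) *
          (C : QubitOp (Fin N)) := by
  obtain ⟨u, hu⟩ := U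
  simp only at h ⊢
  have hu1 : uᴴ * u = 1 := Matrix.mem_unitaryGroup_iff'.mp hu
  have hu2 : u * uᴴ = 1 := Matrix.mem_unitaryGroup_iff.mp hu
  have hu3 : (uᴴ)ᴴ * uᴴ = 1 := by rw [Matrix.conjTranspose_conjTranspose, hu2]
  have hprod : ∀ s : Fin N → Pauli, ∃ (a : QubitOp {i // i ∈ A}) (b : QubitOp {i // i ∉ A}),
      aᴴ * a = 1 ∧ bᴴ * b = 1 ∧ uᴴ * pauliString s * u = localTensor A a b := fun s =>
    exists_localTensor_of_operatorEntanglement_eq_zero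
      (Matrix.conjTranspose_mul_self_mul (Matrix.conjTranspose_mul_self_mul hu3
        (by rw [conjTranspose_pauliString, pauliString_mul_self])) hu1) (h s)
  have hback : ∀ M M' : QubitOp (Fin N), uᴴ * M * u = M' → M = u * M' * uᴴ := by
    rintro M _ rfl
    calc M = u * uᴴ * M * (u * uᴴ) := by rw [hu2, Matrix.one_mul, Matrix.mul_one]
      _ = _ := by simp only [Matrix.mul_assoc]
  have hforth : ∀ M M' : QubitOp (Fin N), u * M * uᴴ = u * M' * uᴴ → M = M' := by
    intro M M' hM
    have h1 : ∀ M : QubitOp (Fin N), uᴴ * (u * M * uᴴ) * u = M := by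
      intro M
      calc _ = uᴴ * u * M * (uᴴ * u) := by simp only [Matrix.mul_assoc]
        _ = M := by rw [hu1, Matrix.one_mul, Matrix.mul_one]
    rw [← h1 M, hM, h1]
  -- Transporting the tensor product by `u` makes the Pauli strings themselves products,
  -- `pauliString s = T a b`.
  let T : QubitOp {i // i ∈ A} → QubitOp {i // i ∉ A} → QubitOp (Fin N) := fun a b =>
    u * localTensor A a b * uᴴ
  have hmul : ∀ a a' b b', T a b * T a' b' = T (a * a') (b * b') := by
    intro a a' b b'
    calc _ = u * localTensor A a b * (uᴴ * u) * localTensor A a' b' * uᴴ := by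
          simp only [T, Matrix.mul_assoc]
      _ = _ := by rw [hu1, Matrix.mul_one, Matrix.mul_assoc u, localTensor_mul]
  have hone : T 1 1 = 1 := by
    simp only [T, localTensor_one, Matrix.mul_one, hu2]
  have hsmul : ∀ (c d : ℂ) a b, T (c • a) (d • b) = (c * d) • T a b := fun c d a b => by
    simp only [T, localTensor_smul_smul, Matrix.mul_smul, Matrix.smul_mul]
  have hT : ∀ s : Fin N → Pauli, ∀ a b, uᴴ * pauliString s * u = localTensor A a b →
      pauliString s = T a b := fun s a b hab => hback _ _ hab
  obtain ⟨V, hV⟩ := exists_local_pauli_frame T hmul hone hsmul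
    (fun a a' b b' hb hab => localTensor_left_cancel hb (hforth _ _ hab))
    (fun s => by
      obtain ⟨a, b, ha, hb, hab⟩ := hprod s
      exact ⟨a, b, ha, hb, hT s a b hab⟩)
  obtain ⟨W, hW⟩ := exists_local_pauli_frame (fun b a => T a b)
    (fun b b' a a' => hmul a a' b b') hone (fun c d b a => by rw [hsmul, mul_comm])
    (fun b b' a a' ha hab => localTensor_right_cancel ha (hforth _ _ hab))
    (fun s => by
      obtain ⟨a, b, ha, hb, hab⟩ := hprod s
      exact ⟨b, a, hb, ha, hT s a b hab⟩)
  obtain ⟨v, hv⟩ := V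
  obtain ⟨w, hw⟩ := W
  simp only at hV hW
  have hv2 : v * vᴴ = 1 := Matrix.mem_unitaryGroup_iff.mp hv
  have hw2 : w * wᴴ = 1 := Matrix.mem_unitaryGroup_iff.mp hw
  have hC : (localTensor A vᴴ wᴴ * uᴴ)ᴴ * (localTensor A vᴴ wᴴ * uᴴ) = 1 :=
    Matrix.conjTranspose_mul_self_mul (by
      rw [conjTranspose_localTensor, localTensor_mul, Matrix.conjTranspose_conjTranspose,
        Matrix.conjTranspose_conjTranspose, hv2, hw2, localTensor_one]) hu3
  -- This choice of `C` is forced by the claimed factorization; it conjugates `pauliString s` to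
  -- `(vᴴ a v) ⊗ (wᴴ b w)`, a multiple of a Pauli string.
  refine ⟨⟨v, hv⟩, ⟨w, hw⟩, ⟨localTensor A vᴴ wᴴ * uᴴ, Matrix.mem_unitaryGroup_iff'.mpr hC⟩,
    mem_cliffordGroup_of_forall _ fun s => ?_, ?_⟩
  · obtain ⟨a, b, ha, hb, hab⟩ := hprod s
    have hP : IsPhasedPauli (T a b) := ⟨0, s, by rw [pow_zero, one_smul, hT s a b hab]⟩
    obtain ⟨c, r, hc⟩ := hV a b ha hb hP
    obtain ⟨d, t, hd⟩ := hW b a hb ha hP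
    refine ⟨c * d, _, Eq.trans ?_ (congrArg ((c * d) • ·) (localTensor_pauliOp r t))⟩
    simp only
    rw [← localTensor_smul_smul, ← hc, ← hd, ← localTensor_mul,
      ← localTensor_mul, ← hab]
    simp only [Matrix.conjTranspose_mul, conjTranspose_localTensor,
      Matrix.conjTranspose_conjTranspose, Matrix.mul_assoc]
  · rw [← Matrix.mul_assoc, localTensor_mul, hv2, hw2, localTensor_one, Matrix.one_mul]

/-- For an `N`-qubit unitary `U`, a bipartition of the qubits into `A` and its complement `B`, and
every entropic measure `S` of operator entanglement: all Heisenberg-evolved Pauli strings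
`U† P U` are unentangled across `A | B` if and only if `U† = (V ⊗ W) C` with `V` unitary on `A`,
`W` unitary on `B` and `C` Clifford. -/
theorem theorem1 (N : ℕ) (A : Finset (Fin N)) (U : QubitUnitary (Fin N)) (S : EntropicMeasure) :
    (∀ s : Fin N → Pauli, operatorEntanglement S A
      ((U : QubitOp (Fin N))ᴴ * pauliString s * (U : QubitOp (Fin N))) = 0) ↔
    ∃ (V : QubitUnitary {i // i ∈ A}) (W : QubitUnitary {i // i ∉ A}) (C : QubitUnitary (Fin N)),
      C ∈ cliffordGroup N ∧
      (U : QubitOp (Fin N))ᴴ =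
        localTensor A (V : QubitOp {i // i ∈ A}) (W : QubitOp {i // i ∉ A}) *
          (C : QubitOp (Fin N)) :=
  ⟨exists_clifford_of_operatorEntanglement_eq_zero,
    fun ⟨_, _, _, hC, hU⟩ s => operatorEntanglement_eq_zero_of_clifford hC hU S s⟩
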